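/- Let $f:\mathbb R^n\to\mathbb R$ be continuously differentiable and $\varphi:\mathbb R^n\to(-\infty,\infty]$ be proper and lower semicontinuous. Put $\psi=f+\varphi$ and $\operatorname{dom}\varphi=\{x:\varphi(x)<\infty\}$. Assume: * (C.1) there are $\bar f\in\mathbb R$ and $\mathsf L>0$ such that $f\ge\bar f$ on $\mathbb R^n$ and $\nabla f$ is Lipschitz continuous with modulus $\mathsf L$; * (C.2) $\varphi$ is $\tau$-weakly convex for some $\tau\ge 0$, i.e. $\varphi+\frac\tau2\|\cdot\|^2$ is convex, and $\varphi\ge\bar\varphi$ for some $\bar\varphi\in\mathbb R$; * (C.3) there is $\mathsf L_\varphi>0$ with $\varphi(x)-\varphi(y)\le\mathsf L_\varphi\|x-y\|$ for all $x,y\in\operatorname{dom}\varphi$. Let $(\Omega,\mathcal F,\{\mathcal F_k\}_{k\ge0},\mathbb P)$ be a filtered probability space, let $\alpha_k>0$ be step sizes, and let $\{x^k\}_{k\ge 0}$ be random vectors in $\mathbb R^n$, adapted to $\{\mathcal F_k\}$ and generated by prox-SGD: almost surely, for all $k\ge0$, $$x^{k+1}=\mathrm{prox}_{\alpha_k\varphi}(x^k-\alpha_kg^k),\qquad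 \mathrm{prox}_{\alpha\varphi}(z)\in\operatorname*{argmin}_{y\in\mathbb R^n}\ \varphi(y)+\tfrac1{2\alpha}\|z-y\|^2,$$ where the $g^k$ are integrable random vectors (for the finitely many $k$ with $\alpha_k\tau\ge1$, where the minimizer need not be unique, any minimizer may be chosen). Assume further: * (C.4) $\mathbb E[g^k\mid\mathcal F_k]=\nabla f(x^k)$ almost surely for all $k$, and there are $\mathsf C,\mathsf D\ge0$ such that $\mathbb E[\|g^k-\nabla f(x^k)\|^2\mid\mathcal F_k]\le\mathsf C[f(x^k)-\bar f]+\mathsf D$ almost surely for all $k$; * (C.5) $\sum_{k}\alpha_k=\infty$ and $\sum_k\alpha_k^2<\infty$. For $\lambda>0$ with $\lambda\tau<1$ the minimizer defining $\mathrm{prox}_{\lambda\varphi}$ is unique; let $F^\lambda_{\mathrm{nat}}(x)=x-\mathrm{prox}_{\lambda\varphi}(x-\lambda\nabla f(x))$ be the natural residual. Then, for every $\lambda>0$ with $\lambda\tau<1$ (in particular for $F_{\mathrm{nat}}=F^1_{\mathrm{nat}}$ if $\tau<1$): 1. If the Moreau envelope $\mathrm{env}_{\theta\psi}(x)=\inf_y\,\psi(y)+\frac1{2\theta}\|x-y\|^2$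 satisfies $\mathbb E[\mathrm{env}_{\theta\psi}(x^0)]<\infty$ for some $\theta>0$ (for example, if $x^0$ is deterministic or square integrable), then $F^\lambda_{\mathrm{nat}}(x^k)$ is integrable for every $k$ and $\lim_{k\to\infty}\mathbb E[\|F^\lambda_{\mathrm{nat}}(x^k)\|]=0$. 2. $\lim_{k\to\infty}\|F^\lambda_{\mathrm{nat}}(x^k)\|=0$ almost surely. -/

import Mathlib

open MeasureTheory ProbabilityTheory Filter Topology

noncomputable section

/-- The effective domain of an extended-real-valued function. -/
def effDom {E : Type*} (h : E → EReal) : Set E := {x | h x < ⊤}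

/-- `h : E → (-∞, ∞]` is `τ`-weakly convex: `h + (τ / 2) ‖·‖²` is convex on its effective domain
(convexity of the domain is part of `ConvexOn`). The value `-∞` is excluded, so that `toReal` is
the actual value of `h` on `effDom h`. -/
def WeaklyConvex {E : Type*} [NormedAddCommGroup E] [NormedSpace ℝ E]
    (τ : ℝ) (h : E → EReal) : Prop :=
  (∀ x, h x ≠ ⊥) ∧ ConvexOn ℝ (effDom h) (fun x => (h x).toReal + τ / 2 * ‖x‖ ^ 2)

/-- The objective `y ↦ h y + ‖z - y‖² / (2 α)` of the proximal subproblem. -/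
def proxObj {E : Type*} [NormedAddCommGroup E] (α : ℝ) (h : E → EReal) (z y : E) : EReal :=
  h y + ((‖z - y‖ ^ 2 / (2 * α) : ℝ) : EReal)

/-- The set `argmin_y h y + ‖z - y‖² / (2 α)` of global minimizers. -/
def proxSet {E : Type*} [NormedAddCommGroup E] (α : ℝ) (h : E → EReal) (z : E) : Set E :=
  {p | ∀ y, proxObj α h z p ≤ proxObj α h z y}

/-- The proximity operator `prox_{α h}`. It is the unique element of `proxSet α h z` whenever
`h` is proper, lower semicontinuous and `τ`-weakly convex, and `0 < α`, `α τ < 1`. -/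
def prox {E : Type*} [NormedAddCommGroup E] (α : ℝ) (h : E → EReal) (z : E) : E :=
  Classical.epsilon (fun p => p ∈ proxSet α h z)

/-- The Moreau envelope `env_{θ h} x = inf_y h y + ‖x - y‖² / (2 θ)`. -/
def moreauEnv {E : Type*} [NormedAddCommGroup E] (θ : ℝ) (h : E → EReal) (x : E) : EReal :=
  ⨅ y, proxObj θ h x y

/-- The natural residual `F_nat^lam x = x - prox_{lam φ} (x - lam ∇f(x))` of `min f + φ`. -/
def natRes {E : Type*} [NormedAddCommGroup E] [InnerProductSpace ℝ E] [CompleteSpace E]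
    (lam : ℝ) (f : E → ℝ) (φ : E → EReal) (x : E) : E :=
  x - prox lam φ (x - lam • gradient f x)

end

/-! The merit function is the Moreau envelope of ψ = f + φ with inverse parameter r = `envRate`,
large enough that ψ + (r/2)‖x - ·‖² is strongly convex. Let p(x) be its minimizer and V(x) ≥ 0 the
envelope minus the lower bound of ψ. The envelope is finite even off dom φ, and the point p(x^k) is
determined by x^k. Testing the optimality of x^{k+1} at p(x^k) therefore leaves, apart from terms of
second order in α_k, only a noise term ⟨p(x^k) - x^k, g^k - ∇f(x^k)⟩ of conditional mean zero. For
small steps this gives (`envGap_step_le`, `setIntegral_envGap_succ_le`) E[V(x^{k+1}) | F_k] ≤ V(x^k)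
- r α_k ‖x^k - p(x^k)‖² + c α_k² (V(x^k) + 1), where the variance is absorbed through f - fbar ≤ 2V.
The Robbins–Siegmund argument bounds V(x^k), in mean and almost surely, and makes Σ α_k E‖x^k -
p(x^k)‖² finite. Since the natural residual F is bounded by a multiple of ‖x - p(x)‖
(`norm_natRes_le`), also Σ α_k E‖F(x^k)‖² < ∞.

As Σ α_k = ∞, this gives smallness only along a subsequence. The rest comes from slow variation: F
is Lipschitz, and Lipschitz continuity of φ on its domain bounds a step by 2α_k(Lφ + ‖g^k‖), so its
conditional second moment is O(α_k²)(V(x^k) + 1). In mean, E‖F(x^k)‖ changes by O(α_k). Along a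
path, the change is O(α_k) plus the increment of a convergent martingale
(`exists_ae_tendsto_compensated`). Either way `tendsto_zero_of_summable_mul_sq` forces convergence
to zero. Integrability of V(x^0) is not needed for the almost sure claim: one restricts to the
F_0-measurable events {V(x^0) ≤ m}, which exhaust Ω. -/

section Deterministic

/-! ### Smooth estimates and weak subgradients -/

variable {E : Type*} [NormedAddCommGroup E] [InnerProductSpace ℝ E]

/-- Descent lemma (with a non-optimal constant). -/
theorem abs_sub_sub_inner_gradient_le [CompleteSpace E] {f : E → ℝ} {K : ℝ}
    (hf : Differentiable ℝ f)
    (hK : ∀ x y, ‖gradient f x - gradient f y‖ ≤ K * ‖x - y‖) (x y : E) :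
    |f y - f x - inner ℝ (gradient f x) (y - x)| ≤ K * ‖y - x‖ ^ 2 := by
  by_cases hxy : y = x
  · subst hxy; simp
  have hpos : 0 < ‖y - x‖ := norm_pos_iff.2 (sub_ne_zero.2 hxy)
  have hK0 : 0 ≤ K := by
    have := (norm_nonneg _).trans (hK y x)
    exact nonneg_of_mul_nonneg_left this hpos
  -- On the segment the derivative differs from its value at x by at most K‖y - x‖; the mean value
  -- inequality then gives the constant K in place of K/2.
  have := (convex_segment x y).norm_image_sub_le_of_norm_hasFDerivWithin_le' (f := f)
    (f' := fun z => fderiv ℝ f z) (φ := fderiv ℝ f x) (C := K * ‖y - x‖) (x := x) (y := y)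
    (fun z _ => (hf z).hasFDerivAt.hasFDerivWithinAt) (fun z hz => by
      have h1 : ‖fderiv ℝ f z - fderiv ℝ f x‖ = ‖gradient f z - gradient f x‖ := by
        rw [gradient, gradient, ← map_sub, LinearIsometryEquiv.norm_map]
      rw [h1]
      refine (hK z x).trans (mul_le_mul_of_nonneg_left ?_ hK0)
      obtain ⟨a, b, ha, hb, hab, rfl⟩ := hz
      have : a • x + b • y - x = b • (y - x) := by
        rw [show a = 1 - b by linarith]; module
      rw [this, norm_smul, Real.norm_of_nonneg hb]
      nlinarith) (left_mem_segment _ _ _) (right_mem_segment _ _ _)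
  have h2 : (fderiv ℝ f x) (y - x) = inner ℝ (gradient f x) (y - x) := by
    rw [gradient, InnerProductSpace.toDual_symm_apply]
  rw [h2, Real.norm_eq_abs] at this
  calc _ ≤ _ := this
    _ = _ := by ring

/-- The gradient step of length 1/(2K) decreases f by at least ‖∇f‖²/(4K), and f cannot fall below
m. -/
theorem norm_gradient_sq_le [CompleteSpace E] {f : E → ℝ} {K m : ℝ}
    (hf : Differentiable ℝ f) (hK0 : 0 < K)
    (hK : ∀ x y, ‖gradient f x - gradient f y‖ ≤ K * ‖x - y‖) (hm : ∀ x, m ≤ f x) (x : E) :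
    ‖gradient f x‖ ^ 2 ≤ 4 * K * (f x - m) := by
  have h1 := (abs_le.1 (abs_sub_sub_inner_gradient_le hf hK x
    (x - (1 / (2 * K)) • gradient f x))).2
  have h2 := hm (x - (1 / (2 * K)) • gradient f x)
  have h3 : x - (1 / (2 * K)) • gradient f x - x = - ((1 / (2 * K)) • gradient f x) := by abel
  rw [h3, inner_neg_right, norm_neg, inner_smul_right, real_inner_self_eq_norm_sq, norm_smul,
    mul_pow, Real.norm_eq_abs, sq_abs] at h1
  have h4 : K * ((1 / (2 * K)) ^ 2 * ‖gradient f x‖ ^ 2) = ‖gradient f x‖ ^ 2 / (4 * K) := by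
    field_simp; ring
  have h5 : 1 / (2 * K) * ‖gradient f x‖ ^ 2 = 2 * (‖gradient f x‖ ^ 2 / (4 * K)) := by
    field_simp; ring
  rw [h4, h5] at h1
  have : ‖gradient f x‖ ^ 2 / (4 * K) ≤ f x - m := by linarith
  rwa [div_le_iff₀ (by positivity), mul_comm] at this

/-- `v` is a subgradient at `p` of the `τ`-weakly convex function `h` with domain `S`. -/
def IsWeakSubgradient (τ : ℝ) (S : Set E) (h : E → ℝ) (v p : E) : Prop :=
  ∀ y ∈ S, h p + inner ℝ v (y - p) - τ / 2 * ‖y - p‖ ^ 2 ≤ h y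

theorem IsWeakSubgradient.monotone {τ : ℝ} {S : Set E} {h : E → ℝ} {v w p q : E}
    (hp : IsWeakSubgradient τ S h v p) (hq : IsWeakSubgradient τ S h w q)
    (hpS : p ∈ S) (hqS : q ∈ S) : -τ * ‖p - q‖ ^ 2 ≤ inner ℝ (v - w) (p - q) := by
  have h1 := hp q hqS
  have h2 := hq p hpS
  rw [← neg_sub p q, inner_neg_right, norm_neg] at h1
  rw [inner_sub_left]
  linarith

/-- Fermat's rule for the sum of a differentiable and a weakly convex function. -/
theorem isWeakSubgradient_of_minimizer [CompleteSpace E] {τ : ℝ} {S : Set E} {h u : E → ℝ}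
    {v p : E} (hc : ConvexOn ℝ S (fun x => h x + τ / 2 * ‖x‖ ^ 2)) (hu : HasGradientAt u v p)
    (hp : p ∈ S) (hmin : ∀ y ∈ S, u p + h p ≤ u y + h y) :
    IsWeakSubgradient τ S h (-v) p := by
  intro y hy
  have hline : HasDerivAt (fun t : ℝ => u (p + t • (y - p))) (inner ℝ v (y - p)) 0 := by
    have h0 : HasDerivAt (fun t : ℝ => p + t • (y - p)) (y - p) 0 := by
      simpa using ((hasDerivAt_id (0 : ℝ)).smul_const (y - p)).const_add p
    have h1 : HasFDerivAt u (InnerProductSpace.toDual ℝ E v) (p + (0 : ℝ) • (y - p)) := by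
      simpa using hu.hasFDerivAt
    have h2 := h1.comp_hasDerivAt (0 : ℝ) h0
    rwa [InnerProductSpace.toDual_apply_apply] at h2
  have hslope := hline.tendsto_slope_zero_right
  simp only [zero_add, zero_smul, add_zero, smul_eq_mul] at hslope
  -- Minimality is tested along the segment from p to y. Convexity of h + (τ/2)‖·‖² bounds the
  -- increment of h by t(h y - h p) + (τ/2) t (1 - t)‖y - p‖²; dividing by t and letting t ↓ 0
  -- leaves the subgradient inequality.
  have hlim : Tendsto (fun t : ℝ => t⁻¹ * (u (p + t • (y - p)) - u p) +
      (h y - h p + τ / 2 * (1 - t) * ‖y - p‖ ^ 2)) (𝓝[>] 0)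
      (𝓝 (inner ℝ v (y - p) + (h y - h p + τ / 2 * (1 - 0) * ‖y - p‖ ^ 2))) := by
    refine hslope.add ?_
    refine Tendsto.mono_left ?_ nhdsWithin_le_nhds
    exact Continuous.tendsto (by fun_prop) 0
  have hge : 0 ≤ inner ℝ v (y - p) + (h y - h p + τ / 2 * (1 - 0) * ‖y - p‖ ^ 2) := by
    refine ge_of_tendsto hlim ?_
    filter_upwards [Ioc_mem_nhdsGT (zero_lt_one' ℝ)] with t ht
    have ht0 : 0 < t := ht.1
    have hcomb : p + t • (y - p) = (1 - t) • p + t • y := by module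
    have hS : p + t • (y - p) ∈ S := by
      rw [hcomb]; exact hc.1 hp hy (by linarith [ht.2]) ht0.le (by ring)
    have h1 := hc.2 hp hy (by linarith [ht.2] : 0 ≤ 1 - t) ht0.le (by ring)
    have h2 := hmin _ hS
    simp only [smul_eq_mul] at h1
    rw [← hcomb] at h1
    have h3 : ‖p + t • (y - p)‖ ^ 2 =
        (1 - t) * ‖p‖ ^ 2 + t * ‖y‖ ^ 2 - t * (1 - t) * ‖y - p‖ ^ 2 := by
      rw [hcomb, norm_add_sq_real, norm_smul, norm_smul, mul_pow, mul_pow, norm_sub_sq_real y p,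
        inner_smul_left, inner_smul_right, Real.norm_eq_abs, Real.norm_eq_abs, sq_abs, sq_abs,
        real_inner_comm y p]
      simp only [conj_trivial]
      ring
    rw [h3] at h1
    have h4 : 0 ≤ t * (t⁻¹ * (u (p + t • (y - p)) - u p) +
      (h y - h p + τ / 2 * (1 - t) * ‖y - p‖ ^ 2)) := by
      rw [mul_add, mul_inv_cancel_left₀ ht0.ne']
      nlinarith
    exact nonneg_of_mul_nonneg_right h4 ht0
  rw [inner_neg_left]
  linarith

theorem hasGradientAt_norm_sub_sq_mul [CompleteSpace E] (z p : E) (c : ℝ) :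
    HasGradientAt (fun y => c / 2 * ‖z - y‖ ^ 2) (c • (p - z)) p := by
  rw [hasGradientAt_iff_hasFDerivAt]
  have h1 := (((hasFDerivAt_id (𝕜 := ℝ) p).const_sub z).norm_sq).const_mul (c / 2)
  refine h1.congr_fderiv ?_
  ext w
  simp
  ring

/-- The minimizer of `u + h + (c / 2) ‖z - ·‖²`. -/
theorem isWeakSubgradient_prox [CompleteSpace E] {τ c : ℝ} {S : Set E} {h u : E → ℝ} {z p : E}
    (hc : ConvexOn ℝ S (fun x => h x + τ / 2 * ‖x‖ ^ 2)) (hu : DifferentiableAt ℝ u p)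
    (hp : p ∈ S)
    (hmin : ∀ y ∈ S, u p + h p + c / 2 * ‖z - p‖ ^ 2 ≤ u y + h y + c / 2 * ‖z - y‖ ^ 2) :
    IsWeakSubgradient τ S h (c • (z - p) - gradient u p) p := by
  have h1 : HasGradientAt (fun y => u y + c / 2 * ‖z - y‖ ^ 2) (gradient u p + c • (p - z)) p := by
    rw [hasGradientAt_iff_hasFDerivAt, map_add]
    exact hu.hasGradientAt.hasFDerivAt.add (hasGradientAt_norm_sub_sq_mul z p c).hasFDerivAt
  have := isWeakSubgradient_of_minimizer hc h1 hp (fun y hy => by linarith [hmin y hy])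
  convert this using 1
  module

/-- Stability of solutions of `v ∈ ∂h(p)`. -/
theorem norm_sub_le_of_isWeakSubgradient {τ c : ℝ} {S : Set E} {h : E → ℝ} {v w p q a : E}
    (hp : IsWeakSubgradient τ S h v p) (hq : IsWeakSubgradient τ S h w q)
    (hpS : p ∈ S) (hqS : q ∈ S) (hvw : v - w = a - c • (p - q)) :
    (c - τ) * ‖p - q‖ ≤ ‖a‖ := by
  have h1 := hp.monotone hq hpS hqS
  rw [hvw, inner_sub_left, inner_smul_left, real_inner_self_eq_norm_sq] at h1
  simp only [conj_trivial] at h1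
  have h2 := real_inner_le_norm a (p - q)
  -- Weak monotonicity and Cauchy–Schwarz give (c - τ)‖p - q‖² ≤ ‖a‖‖p - q‖; one factor is
  -- cancelled.
  rcases (norm_nonneg (p - q)).eq_or_lt with h0 | h0
  · rw [← h0]; simp
  · refine le_of_mul_le_mul_right ?_ h0
    nlinarith

end Deterministic

/-! ### Existence and optimality of proximal points -/

section ProxSet

variable {E : Type*} [NormedAddCommGroup E]

theorem LowerSemicontinuous.exists_mem_proxSet [ProperSpace E] {φ : E → EReal} {α m : ℝ}
    (hα : 0 < α) (hne : (effDom φ).Nonempty) (hlsc : LowerSemicontinuous φ)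
    (hm : ∀ y, (m : EReal) ≤ φ y) (z : E) : (proxSet α φ z).Nonempty := by
  obtain ⟨y₀, hy₀⟩ := hne
  have hy₀' : φ y₀ < ⊤ := hy₀
  have hbot : ∀ y, φ y ≠ ⊥ := fun y h => by
    have := hm y
    rw [h] at this
    exact absurd this (by simp)
  set A : ℝ := (φ y₀).toReal + ‖z - y₀‖ ^ 2 / (2 * α) with hA
  have hA' : proxObj α φ z y₀ = (A : EReal) := by
    rw [proxObj, hA, EReal.coe_add, EReal.coe_toReal hy₀'.ne (hbot _)]
  have hobj : LowerSemicontinuous (proxObj α φ z) := by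
    refine LowerSemicontinuous.add' hlsc ?_ ?_
    · have : Continuous fun y => (((‖z - y‖ ^ 2 / (2 * α) : ℝ)) : EReal) :=
        continuous_coe_real_ereal.comp (by fun_prop)
      exact this.lowerSemicontinuous
    · intro y
      exact EReal.continuousAt_add (Or.inr (EReal.coe_ne_bot _)) (Or.inr (EReal.coe_ne_top _))
  -- The summand 1 makes R ≥ 1, so ‖z - y‖ > R implies ‖z - y‖² ≥ 2α(A - m): outside the ball the
  -- objective is at least its value A at y₀. The maximum below keeps y₀ in the ball.
  set R : ℝ := 2 * α * (A - m) + 1 with hR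
  obtain ⟨p, hpB, hp⟩ := LowerSemicontinuousOn.exists_isMinOn (s := Metric.closedBall z
      (max R ‖z - y₀‖)) ⟨y₀, by simp [dist_eq_norm, norm_sub_rev]⟩
      (isCompact_closedBall _ _) (hobj.lowerSemicontinuousOn _)
  have hpy₀ : proxObj α φ z p ≤ A := by
    rw [← hA']
    exact hp (by simp [dist_eq_norm, norm_sub_rev])
  refine ⟨p, fun y => ?_⟩
  by_cases hy : y ∈ Metric.closedBall z (max R ‖z - y₀‖)
  · exact hp hy
  · have hy1 : R < ‖z - y‖ := by
      rw [Metric.mem_closedBall, not_le, dist_eq_norm, norm_sub_rev y z] at hy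
      exact (le_max_left _ _).trans_lt hy
    refine hpy₀.trans ?_
    have hAm : m ≤ A := by
      have h1 : m ≤ (φ y₀).toReal := by
        rw [← EReal.coe_le_coe_iff, EReal.coe_toReal hy₀'.ne (hbot _)]
        exact hm y₀
      have : 0 ≤ ‖z - y₀‖ ^ 2 / (2 * α) := by positivity
      linarith
    have h1 : A ≤ m + ‖z - y‖ ^ 2 / (2 * α) := by
      have : A - m ≤ ‖z - y‖ ^ 2 / (2 * α) := by
        rw [le_div_iff₀ (by positivity)]
        have : 0 ≤ 2 * α * (A - m) := by
          have := sub_nonneg.2 hAm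
          positivity
        nlinarith
      linarith
    calc (A : EReal) ≤ ((m + ‖z - y‖ ^ 2 / (2 * α) : ℝ) : EReal) := by exact_mod_cast h1
      _ = (m : EReal) + ((‖z - y‖ ^ 2 / (2 * α) : ℝ) : EReal) := EReal.coe_add _ _
      _ ≤ _ := by
        rw [proxObj]
        gcongr
        exact hm y

theorem mem_effDom_of_mem_proxSet {φ : E → EReal} {α : ℝ} {z p : E}
    (hne : (effDom φ).Nonempty) (hp : p ∈ proxSet α φ z) : p ∈ effDom φ := by
  obtain ⟨y, hy⟩ := hne
  by_contra h
  have h1 : φ p = ⊤ := by simpa [effDom] using h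
  have h2 := hp y
  rw [proxObj, proxObj, h1, EReal.top_add_of_ne_bot (EReal.coe_ne_bot _), top_le_iff] at h2
  exact (EReal.add_lt_top (ne_of_lt hy) (EReal.coe_ne_top _)).ne h2

theorem toReal_proxObj_le {φ : E → EReal} {α : ℝ} {z p : E} (hbot : ∀ y, φ y ≠ ⊥)
    (hp : p ∈ proxSet α φ z) {y : E} (hy : y ∈ effDom φ) :
    (φ p).toReal + α⁻¹ / 2 * ‖z - p‖ ^ 2 ≤ (φ y).toReal + α⁻¹ / 2 * ‖z - y‖ ^ 2 := by
  have hpd : p ∈ effDom φ := mem_effDom_of_mem_proxSet ⟨y, hy⟩ hp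
  have h := hp y
  rw [proxObj, proxObj, ← EReal.coe_toReal (ne_of_lt hy) (hbot y),
    ← EReal.coe_toReal (ne_of_lt hpd) (hbot p), ← EReal.coe_add, ← EReal.coe_add,
    EReal.coe_le_coe_iff] at h
  have h1 : ∀ t : ℝ, α⁻¹ / 2 * t = t / (2 * α) := fun t => by
    rw [div_eq_mul_inv, div_eq_mul_inv, mul_inv]; ring
  rw [h1, h1]
  exact h

end ProxSet

/-! ### The Moreau envelope as merit function -/

theorem effDom_coe_add {E : Type*} (f : E → ℝ) (φ : E → EReal) :
    effDom (fun y => (f y : EReal) + φ y) = effDom φ := by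
  ext x
  simp only [effDom, Set.mem_ofPred_eq]
  constructor
  · intro h
    by_contra h'
    rw [not_lt, top_le_iff] at h'
    simp [h'] at h
  · intro h
    exact EReal.add_lt_top (EReal.coe_ne_top _) h.ne

/-- The standing assumptions on the composite objective `f + φ`. -/
structure IsCompositeProblem {E : Type*} [NormedAddCommGroup E] [InnerProductSpace ℝ E]
    [CompleteSpace E] (f : E → ℝ) (φ : E → EReal) (K τ fbar φbar : ℝ) : Prop where
  differentiable : Differentiable ℝ f
  pos : 0 < K
  lipschitz : ∀ x y, ‖gradient f x - gradient f y‖ ≤ K * ‖x - y‖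
  le_f : ∀ x, fbar ≤ f x
  nonneg : 0 ≤ τ
  weaklyConvex : WeaklyConvex τ φ
  proper : (effDom φ).Nonempty
  lsc : LowerSemicontinuous φ
  le_φ : ∀ x, (φbar : EReal) ≤ φ x

/-- The (inverse) parameter of the Moreau envelope used as a merit function. -/
def envRate (K τ : ℝ) : ℝ := 2 * K + τ + 2

/-- The proximal point `prox_{θ (f + φ)} x` with `θ⁻¹ = envRate K τ`. -/
noncomputable def envProx {E : Type*} [NormedAddCommGroup E] (K τ : ℝ) (f : E → ℝ)
    (φ : E → EReal) (x : E) : E :=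
  prox (envRate K τ)⁻¹ (fun y => (f y : EReal) + φ y) x

/-- The gap `env_{θ (f + φ)} x - m` with `θ⁻¹ = envRate K τ`. -/
noncomputable def envGap {E : Type*} [NormedAddCommGroup E] (K τ : ℝ) (f : E → ℝ)
    (φ : E → EReal) (m : ℝ) (x : E) : ℝ :=
  f (envProx K τ f φ x) + (φ (envProx K τ f φ x)).toReal
    + envRate K τ / 2 * ‖x - envProx K τ f φ x‖ ^ 2 - m

theorem envGap_eq {E : Type*} [NormedAddCommGroup E] (f : E → ℝ) (φ : E → EReal)
    (K τ fbar φbar : ℝ) (x : E) :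
    envGap K τ f φ (fbar + φbar) x =
      f (envProx K τ f φ x) - fbar + ((φ (envProx K τ f φ x)).toReal - φbar)
        + envRate K τ / 2 * ‖x - envProx K τ f φ x‖ ^ 2 := by
  unfold envGap; ring

namespace IsCompositeProblem

variable {E : Type*} [NormedAddCommGroup E] [InnerProductSpace ℝ E] [CompleteSpace E]
  {f : E → ℝ} {φ : E → EReal} {K τ fbar φbar : ℝ}

theorem envRate_pos (H : IsCompositeProblem f φ K τ fbar φbar) : 0 < envRate K τ := by
  have := H.pos
  have := H.nonneg
  unfold envRate
  positivity

theorem le_toReal (H : IsCompositeProblem f φ K τ fbar φbar) {x : E} (hx : x ∈ effDom φ) :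
    φbar ≤ (φ x).toReal := by
  rw [← EReal.coe_le_coe_iff, EReal.coe_toReal (ne_of_lt hx) (H.weaklyConvex.1 x)]
  exact H.le_φ x

theorem add_ne_bot (H : IsCompositeProblem f φ K τ fbar φbar) (x : E) :
    (f x : EReal) + φ x ≠ ⊥ := by
  simp [EReal.add_eq_bot_iff, H.weaklyConvex.1 x]

theorem toReal_add (H : IsCompositeProblem f φ K τ fbar φbar) {x : E} (hx : x ∈ effDom φ) :
    ((f x : EReal) + φ x).toReal = f x + (φ x).toReal := by
  rw [EReal.toReal_add (EReal.coe_ne_top _) (EReal.coe_ne_bot _) (ne_of_lt hx)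
    (H.weaklyConvex.1 x), EReal.toReal_coe]

theorem envProx_mem_proxSet [ProperSpace E] (H : IsCompositeProblem f φ K τ fbar φbar) (x : E) :
    envProx K τ f φ x ∈ proxSet (envRate K τ)⁻¹ (fun y => (f y : EReal) + φ y) x := by
  have hlsc : LowerSemicontinuous fun y => (f y : EReal) + φ y := by
    refine LowerSemicontinuous.add' ?_ H.lsc ?_
    · have : Continuous fun y => (f y : EReal) :=
        continuous_coe_real_ereal.comp H.differentiable.continuous
      exact this.lowerSemicontinuous
    · intro y
      exact EReal.continuousAt_add (Or.inl (EReal.coe_ne_top _)) (Or.inl (EReal.coe_ne_bot _))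
  obtain ⟨p, hp⟩ := LowerSemicontinuous.exists_mem_proxSet (m := fbar + φbar)
    (inv_pos.2 H.envRate_pos) (by rw [effDom_coe_add]; exact H.proper) hlsc
    (fun y => by
      rw [EReal.coe_add]
      exact add_le_add (by exact_mod_cast H.le_f y) (H.le_φ y)) x
  exact Classical.epsilon_spec (p := fun p => p ∈ proxSet (envRate K τ)⁻¹
    (fun y => (f y : EReal) + φ y) x) ⟨p, hp⟩

theorem envProx_mem [ProperSpace E] (H : IsCompositeProblem f φ K τ fbar φbar) (x : E) :
    envProx K τ f φ x ∈ effDom φ := by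
  have := mem_effDom_of_mem_proxSet (by rw [effDom_coe_add]; exact H.proper) (H.envProx_mem_proxSet x)
  rwa [effDom_coe_add] at this

theorem envProx_le [ProperSpace E] (H : IsCompositeProblem f φ K τ fbar φbar) (x : E) {y : E}
    (hy : y ∈ effDom φ) :
    f (envProx K τ f φ x) + (φ (envProx K τ f φ x)).toReal
      + envRate K τ / 2 * ‖x - envProx K τ f φ x‖ ^ 2
      ≤ f y + (φ y).toReal + envRate K τ / 2 * ‖x - y‖ ^ 2 := by
  have := toReal_proxObj_le H.add_ne_bot (H.envProx_mem_proxSet x) (by rwa [effDom_coe_add])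
  rwa [inv_inv, H.toReal_add hy, H.toReal_add (H.envProx_mem x)] at this

theorem isWeakSubgradient_envProx [ProperSpace E] (H : IsCompositeProblem f φ K τ fbar φbar)
    (x : E) : IsWeakSubgradient τ (effDom φ) (fun y => (φ y).toReal)
      (envRate K τ • (x - envProx K τ f φ x) - gradient f (envProx K τ f φ x))
      (envProx K τ f φ x) :=
  isWeakSubgradient_prox H.weaklyConvex.2 (H.differentiable _) (H.envProx_mem x)
    (fun _ hy => H.envProx_le x hy)

/-- Stability of the inclusion r(x - p) - ∇f(p) ∈ ∂φ(p): since r - τ = 2K + 2, the K‖p - q‖ caused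
by ∇f is absorbed. Continuity of x ↦ p(x) is what makes p(x^k) adapted. -/
theorem norm_envProx_sub_le [ProperSpace E] (H : IsCompositeProblem f φ K τ fbar φbar) (x y : E) :
    ‖envProx K τ f φ x - envProx K τ f φ y‖ ≤ envRate K τ * ‖x - y‖ := by
  have h1 := norm_sub_le_of_isWeakSubgradient (c := envRate K τ)
    (a := envRate K τ • (x - y) - (gradient f (envProx K τ f φ x) - gradient f (envProx K τ f φ y)))
    (H.isWeakSubgradient_envProx x) (H.isWeakSubgradient_envProx y) (H.envProx_mem x)
    (H.envProx_mem y) (by module)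
  have h2 := H.lipschitz (envProx K τ f φ x) (envProx K τ f φ y)
  have h3 := norm_sub_le (envRate K τ • (x - y))
    (gradient f (envProx K τ f φ x) - gradient f (envProx K τ f φ y))
  rw [norm_smul, Real.norm_of_nonneg H.envRate_pos.le] at h3
  have h4 : 0 ≤ (K + 1) * ‖envProx K τ f φ x - envProx K τ f φ y‖ :=
    mul_nonneg (by linarith [H.pos]) (norm_nonneg _)
  have h5 : envRate K τ - τ = 2 * K + 2 := by unfold envRate; ring
  rw [h5] at h1
  nlinarith

theorem continuous_envProx [ProperSpace E] (H : IsCompositeProblem f φ K τ fbar φbar) :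
    Continuous (envProx K τ f φ) := by
  have : LipschitzWith (Real.toNNReal (envRate K τ)) (envProx K τ f φ) :=
    LipschitzWith.of_dist_le_mul fun x y => by
      rw [dist_eq_norm, dist_eq_norm, Real.coe_toNNReal _ H.envRate_pos.le]
      exact H.norm_envProx_sub_le x y
  exact this.continuous

theorem continuous_gradient (H : IsCompositeProblem f φ K τ fbar φbar) :
    Continuous (gradient f) := by
  have : LipschitzWith (Real.toNNReal K) (gradient f) :=
    LipschitzWith.of_dist_le_mul fun x y => by
      rw [dist_eq_norm, dist_eq_norm, Real.coe_toNNReal _ H.pos.le]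
      exact H.lipschitz x y
  exact this.continuous

theorem measurable_envGap [ProperSpace E] [MeasurableSpace E] [BorelSpace E]
    (H : IsCompositeProblem f φ K τ fbar φbar) (m : ℝ) : Measurable (envGap K τ f φ m) := by
  have hP := H.continuous_envProx
  have h1 : Measurable fun x => (φ (envProx K τ f φ x)).toReal :=
    measurable_ereal_toReal.comp (H.lsc.measurable.comp hP.measurable)
  have h2 : Continuous fun x => f (envProx K τ f φ x) := H.differentiable.continuous.comp hP
  have h3 : Continuous fun x => envRate K τ / 2 * ‖x - envProx K τ f φ x‖ ^ 2 := by fun_prop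
  exact ((h2.measurable.add h1).add h3.measurable).sub_const m

theorem envGap_nonneg [ProperSpace E] (H : IsCompositeProblem f φ K τ fbar φbar) (x : E) :
    0 ≤ envGap K τ f φ (fbar + φbar) x := by
  have h1 := H.le_f (envProx K τ f φ x)
  have h2 := H.le_toReal (H.envProx_mem x)
  have h3 : 0 ≤ envRate K τ / 2 * ‖x - envProx K τ f φ x‖ ^ 2 := by
    have := H.envRate_pos
    positivity
  rw [envGap_eq]
  linarith

theorem norm_sub_envProx_sq_le [ProperSpace E] (H : IsCompositeProblem f φ K τ fbar φbar) (x : E) :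
    ‖x - envProx K τ f φ x‖ ^ 2 ≤ envGap K τ f φ (fbar + φbar) x := by
  have h1 := H.le_f (envProx K τ f φ x)
  have h2 := H.le_toReal (H.envProx_mem x)
  have h3 : 1 ≤ envRate K τ / 2 := by
    unfold envRate
    linarith [H.pos, H.nonneg]
  rw [envGap_eq]
  nlinarith [sq_nonneg ‖x - envProx K τ f φ x‖]

/-- This turns the variance bound C(f - fbar) + D into one in terms of the merit function. Expand f
around p and use ‖∇f(p)‖² ≤ 4K(f(p) - fbar) to absorb the linear term. -/
theorem f_sub_le_envGap [ProperSpace E] (H : IsCompositeProblem f φ K τ fbar φbar) (x : E) :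
    f x - fbar ≤ 2 * envGap K τ f φ (fbar + φbar) x := by
  set p := envProx K τ f φ x with hp
  have h1 := (abs_le.1 (abs_sub_sub_inner_gradient_le H.differentiable H.lipschitz p x)).2
  have h2 := real_inner_le_norm (gradient f p) (x - p)
  have h3 := norm_gradient_sq_le H.differentiable H.pos H.lipschitz H.le_f p
  have h4 := H.le_toReal (H.envProx_mem x)
  have h5 : ‖gradient f p‖ * ‖x - p‖ ≤ (f p - fbar) + K * ‖x - p‖ ^ 2 := by
    have hK := H.pos
    have : 0 ≤ (‖gradient f p‖ - 2 * K * ‖x - p‖) ^ 2 := sq_nonneg _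
    have : 4 * K * (‖gradient f p‖ * ‖x - p‖) ≤ 4 * K * ((f p - fbar) + K * ‖x - p‖ ^ 2) := by
      nlinarith
    exact le_of_mul_le_mul_left this (by positivity)
  have h6 : (2 * K) * ‖x - p‖ ^ 2 ≤ envRate K τ * ‖x - p‖ ^ 2 := by
    refine mul_le_mul_of_nonneg_right ?_ (sq_nonneg _)
    unfold envRate
    linarith [H.nonneg]
  rw [envGap_eq, ← hp]
  linarith

theorem envGap_le [ProperSpace E] (H : IsCompositeProblem f φ K τ fbar φbar) (x : E) {y : E}
    (hy : y ∈ effDom φ) (m : ℝ) :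
    envGap K τ f φ m x ≤ f y + (φ y).toReal + envRate K τ / 2 * ‖x - y‖ ^ 2 - m := by
  have := H.envProx_le x hy
  unfold envGap
  linarith

/-- The Moreau envelopes for different parameters are comparable. -/
theorem envGap_le_moreauEnv [ProperSpace E] (H : IsCompositeProblem f φ K τ fbar φbar) {θ : ℝ}
    (hθ : 0 < θ) (x : E) :
    ((envGap K τ f φ (fbar + φbar) x / (1 + envRate K τ * θ) + (fbar + φbar) : ℝ) : EReal)
      ≤ moreauEnv θ (fun y => (f y : EReal) + φ y) x := by
  refine le_iInf fun y => ?_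
  by_cases hy : y ∈ effDom φ
  · rw [proxObj, ← EReal.coe_toReal (ne_of_lt hy) (H.weaklyConvex.1 y), ← EReal.coe_add,
      ← EReal.coe_add, EReal.coe_le_coe_iff]
    have h1 := H.envGap_le x hy (fbar + φbar)
    have h2 := H.le_f y
    have h3 := H.le_toReal hy
    have hr := H.envRate_pos
    rw [← le_sub_iff_add_le, div_le_iff₀ (by positivity)]
    -- Multiplying the θ-objective minus the lower bound by 1 + rθ dominates the r-objective: the
    -- factor rθ turns 1/(2θ) into r/2, and the remaining terms are nonnegative.
    have h4 : 0 ≤ envRate K τ * θ * (f y + (φ y).toReal - (fbar + φbar)) :=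
      mul_nonneg (by positivity) (by linarith)
    have h5 : 0 ≤ ‖x - y‖ ^ 2 / (2 * θ) := by positivity
    have h6 : ‖x - y‖ ^ 2 / (2 * θ) * (envRate K τ * θ) = envRate K τ / 2 * ‖x - y‖ ^ 2 := by
      field_simp
    nlinarith
  · have : φ y = ⊤ := by simpa [effDom] using hy
    simp [proxObj, this]

/-! ### The natural residual -/

theorem natRes_prox_mem [ProperSpace E] (H : IsCompositeProblem f φ K τ fbar φbar) {lam : ℝ}
    (hlam : 0 < lam) (z : E) : prox lam φ z ∈ proxSet lam φ z :=
  Classical.epsilon_spec (p := fun p => p ∈ proxSet lam φ z)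
    (LowerSemicontinuous.exists_mem_proxSet hlam H.proper H.lsc H.le_φ z)

theorem isWeakSubgradient_of_mem_proxSet (H : IsCompositeProblem f φ K τ fbar φbar) {α : ℝ}
    {z p : E} (hp : p ∈ proxSet α φ z) :
    IsWeakSubgradient τ (effDom φ) (fun y => (φ y).toReal) (α⁻¹ • (z - p)) p := by
  have := isWeakSubgradient_prox (u := fun _ => (0 : ℝ)) (c := α⁻¹) (z := z) H.weaklyConvex.2
    (differentiableAt_const _) (mem_effDom_of_mem_proxSet H.proper hp)
    (fun y hy => by
      have := toReal_proxObj_le H.weaklyConvex.1 hp hy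
      linarith)
  simpa [gradient_fun_const] using this

/-- The natural residual is controlled by the residual of the Moreau envelope. -/
theorem norm_natRes_le [ProperSpace E] (H : IsCompositeProblem f φ K τ fbar φbar) {lam : ℝ}
    (hlam : 0 < lam) (hlt : lam * τ < 1) (x : E) :
    ‖natRes lam f φ x‖ ≤
      (1 + (envRate K τ + K + lam⁻¹) / (lam⁻¹ - τ)) * ‖x - envProx K τ f φ x‖ := by
  have hq := H.natRes_prox_mem hlam (x - lam • gradient f x)
  have hc : 0 < lam⁻¹ - τ := by
    rw [sub_pos, ← one_div, lt_div_iff₀ hlam]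
    linarith
  set p := envProx K τ f φ x with hp
  unfold natRes
  set q := prox lam φ (x - lam • gradient f x) with hqdef
  -- The subgradients r(x - p) - ∇f(p) at p and lam⁻¹(x - q) - ∇f(x) at q differ by a - lam⁻¹(p -
  -- q), where a is of order ‖x - p‖.
  have h1 := norm_sub_le_of_isWeakSubgradient (c := lam⁻¹)
    (a := envRate K τ • (x - p) - (gradient f p - gradient f x) - lam⁻¹ • (x - p))
    (H.isWeakSubgradient_envProx x) (H.isWeakSubgradient_of_mem_proxSet hq) (H.envProx_mem x)
    (mem_effDom_of_mem_proxSet H.proper hq) (by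
      rw [← hp, sub_right_comm x, smul_sub _ (x - q), inv_smul_smul₀ hlam.ne']
      module)
  have h2 := H.lipschitz p x
  rw [norm_sub_rev p x] at h2
  have h3 := norm_sub_le (envRate K τ • (x - p) - (gradient f p - gradient f x)) (lam⁻¹ • (x - p))
  have h4 := norm_sub_le (envRate K τ • (x - p)) (gradient f p - gradient f x)
  rw [norm_smul, Real.norm_of_nonneg (inv_pos.2 hlam).le] at h3
  rw [norm_smul, Real.norm_of_nonneg H.envRate_pos.le] at h4
  have h5 : ‖p - q‖ ≤ (envRate K τ + K + lam⁻¹) / (lam⁻¹ - τ) * ‖x - p‖ := by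
    rw [div_mul_eq_mul_div, le_div_iff₀ hc]
    linarith
  have h6 : ‖x - q‖ ≤ ‖x - p‖ + ‖p - q‖ := norm_sub_le_norm_sub_add_norm_sub x p q
  linarith

theorem norm_natRes_sub_le [ProperSpace E] (H : IsCompositeProblem f φ K τ fbar φbar) {lam : ℝ}
    (hlam : 0 < lam) (hlt : lam * τ < 1) (x y : E) :
    ‖natRes lam f φ x - natRes lam f φ y‖ ≤ (1 + (lam⁻¹ + K) / (lam⁻¹ - τ)) * ‖x - y‖ := by
  have hq := H.natRes_prox_mem hlam (x - lam • gradient f x)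
  have hq' := H.natRes_prox_mem hlam (y - lam • gradient f y)
  have hc : 0 < lam⁻¹ - τ := by
    rw [sub_pos, ← one_div, lt_div_iff₀ hlam]
    linarith
  unfold natRes
  set q := prox lam φ (x - lam • gradient f x) with hqdef
  set q' := prox lam φ (y - lam • gradient f y) with hqdef'
  have h1 := norm_sub_le_of_isWeakSubgradient (c := lam⁻¹)
    (a := lam⁻¹ • (x - y) - (gradient f x - gradient f y))
    (H.isWeakSubgradient_of_mem_proxSet hq) (H.isWeakSubgradient_of_mem_proxSet hq')
    (mem_effDom_of_mem_proxSet H.proper hq) (mem_effDom_of_mem_proxSet H.proper hq') (by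
      rw [sub_right_comm x, sub_right_comm y, smul_sub _ (x - q), smul_sub _ (y - q'),
        inv_smul_smul₀ hlam.ne', inv_smul_smul₀ hlam.ne']
      module)
  have h2 := H.lipschitz x y
  have h3 := norm_sub_le (lam⁻¹ • (x - y)) (gradient f x - gradient f y)
  rw [norm_smul, Real.norm_of_nonneg (inv_pos.2 hlam).le] at h3
  have h5 : ‖q - q'‖ ≤ (lam⁻¹ + K) / (lam⁻¹ - τ) * ‖x - y‖ := by
    rw [div_mul_eq_mul_div, le_div_iff₀ hc]
    linarith
  have h6 : ‖x - q - (y - q')‖ ≤ ‖x - y‖ + ‖q - q'‖ := by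
    rw [show x - q - (y - q') = (x - y) - (q - q') by abel]
    exact norm_sub_le _ _
  linarith

/-! ### One-step estimates -/

/-- One step of prox-SGD decreases the Moreau envelope up to noise. -/
theorem envGap_step_le [ProperSpace E] (H : IsCompositeProblem f φ K τ fbar φbar) {α : ℝ}
    (hα : 0 < α) (hα1 : α * (2 * K + envRate K τ) ≤ 1 / 2) {x x' g : E}
    (hx' : x' ∈ proxSet α φ (x - α • g)) :
    envGap K τ f φ (fbar + φbar) x' ≤ envGap K τ f φ (fbar + φbar) x
      - envRate K τ * α * ‖x - envProx K τ f φ x‖ ^ 2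
      + envRate K τ * α / (1 - α * τ) * inner ℝ (envProx K τ f φ x - x) (g - gradient f x)
      + 2 * envRate K τ * α ^ 2 * ‖g - gradient f x‖ ^ 2 := by
  set r := envRate K τ with hr
  have hrpos : 0 < r := H.envRate_pos
  have hrdef : r = 2 * K + τ + 2 := rfl
  set p := envProx K τ f φ x with hp
  set e := g - gradient f x with he
  have hατ : α * τ ≤ 1 / 2 := by nlinarith [H.pos]
  have hατ0 : 0 ≤ α * τ := mul_nonneg hα.le H.nonneg
  have hx'S := mem_effDom_of_mem_proxSet H.proper hx'
  have hpS := H.envProx_mem x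
  have h1 := H.isWeakSubgradient_of_mem_proxSet hx' p hpS
  have h2 := (abs_le.1 (abs_sub_sub_inner_gradient_le H.differentiable H.lipschitz x x')).2
  have h3 := (abs_le.1 (abs_sub_sub_inner_gradient_le H.differentiable H.lipschitz x p)).1
  have h4 := H.envProx_le x hx'S
  rw [← hp, ← hr] at h4
  have h5 := H.envGap_le x' hpS (fbar + φbar)
  rw [← hp, ← hr] at h5
  have h6 : envGap K τ f φ (fbar + φbar) x =
    f p + (φ p).toReal + r / 2 * ‖x - p‖ ^ 2 - (fbar + φbar) := rfl
  have hg : x - α • g - x' = (x - x') - α • (gradient f x + e) := by rw [he]; module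
  have h7 : α * inner ℝ (α⁻¹ • (x - α • g - x')) (p - x') =
      inner ℝ (x - x') (p - x') - α * inner ℝ (gradient f x) (p - x')
        - α * inner ℝ e (p - x') := by
    rw [hg, inner_smul_left, inner_sub_left, inner_smul_left, inner_add_left]
    simp only [conj_trivial]
    field_simp
    ring
  have h8 : inner ℝ (x - x') (p - x') = (‖x - x'‖ ^ 2 + ‖x' - p‖ ^ 2 - ‖x - p‖ ^ 2) / 2 := by
    have := norm_sub_sq_real (x - x') (p - x')
    rw [sub_sub_sub_cancel_right, norm_sub_rev p x'] at this
    linarith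
  have h9 : inner ℝ (gradient f x) (p - x') =
      inner ℝ (gradient f x) (p - x) - inner ℝ (gradient f x) (x' - x) := by
    rw [← inner_sub_right, sub_sub_sub_cancel_right]
  -- The first part will have conditional mean zero, because p - x depends only on x. The second is
  -- split by Young's inequality into noise of order α² and a quarter of ‖x - x'‖².
  have h10 : inner ℝ e (p - x') = inner ℝ (p - x) e + inner ℝ e (x - x') := by
    rw [real_inner_comm e (p - x), ← inner_add_right, sub_add_sub_cancel]
  have h11 : inner ℝ e (x - x') ≤ α * ‖e‖ ^ 2 + ‖x - x'‖ ^ 2 / (4 * α) := by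
    refine (real_inner_le_norm _ _).trans ?_
    have : 0 ≤ (2 * α * ‖e‖ - ‖x - x'‖) ^ 2 / (4 * α) := by positivity
    have h' : (2 * α * ‖e‖ - ‖x - x'‖) ^ 2 / (4 * α) =
      α * ‖e‖ ^ 2 + ‖x - x'‖ ^ 2 / (4 * α) - ‖e‖ * ‖x - x'‖ := by field_simp; ring
    linarith
  have h11' : α * inner ℝ e (x - x') ≤ α ^ 2 * ‖e‖ ^ 2 + ‖x - x'‖ ^ 2 / 4 := by
    have := mul_le_mul_of_nonneg_left h11 hα.le
    have h' : α * (α * ‖e‖ ^ 2 + ‖x - x'‖ ^ 2 / (4 * α)) =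
      α ^ 2 * ‖e‖ ^ 2 + ‖x - x'‖ ^ 2 / 4 := by field_simp
    linarith
  have h1' := mul_le_mul_of_nonneg_left h1 hα.le
  rw [mul_sub, mul_add, h7, h8, h9, h10, norm_sub_rev p x'] at h1'
  rw [norm_sub_rev x' x] at h2
  rw [norm_sub_rev p x] at h3
  have h2' := mul_le_mul_of_nonneg_left h2 hα.le
  have h3' := mul_le_mul_of_nonneg_left h3 hα.le
  have h4' := mul_le_mul_of_nonneg_left h4 hα.le
  -- All terms in ‖x - x'‖² collect here: 1 from the three-point identity, less 1/2 from Young, 2αK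
  -- from the descent lemma and αr from the minimality of p.
  have h12 : 0 ≤ (1 / 2 - α * (2 * K + r)) * ‖x - x'‖ ^ 2 :=
    mul_nonneg (by linarith) (sq_nonneg _)
  have key : (1 - α * τ) * ‖x' - p‖ ^ 2 ≤ (1 - α * τ - 2 * α) * ‖x - p‖ ^ 2
      + 2 * α * inner ℝ (p - x) e + 2 * α ^ 2 * ‖e‖ ^ 2 := by
    -- The choice r = 2K + τ + 2 leaves exactly the contraction 2α.
    have : (1 - α * τ - 2 * α) * ‖x - p‖ ^ 2 = (1 + 2 * α * K - α * r) * ‖x - p‖ ^ 2 := by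
      rw [hrdef]; ring
    rw [this]
    linarith
  have hd : 0 < 1 - α * τ := by linarith
  have key2 : ‖x' - p‖ ^ 2 ≤ ‖x - p‖ ^ 2 - 2 * α * ‖x - p‖ ^ 2
      + 2 * α / (1 - α * τ) * inner ℝ (p - x) e + 4 * α ^ 2 * ‖e‖ ^ 2 := by
    refine le_of_mul_le_mul_left ?_ hd
    refine key.trans ?_
    have e1 : (1 - α * τ) * (‖x - p‖ ^ 2 - 2 * α * ‖x - p‖ ^ 2
      + 2 * α / (1 - α * τ) * inner ℝ (p - x) e + 4 * α ^ 2 * ‖e‖ ^ 2) =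
      (1 - α * τ) * ‖x - p‖ ^ 2 - (1 - α * τ) * (2 * α * ‖x - p‖ ^ 2)
      + 2 * α * inner ℝ (p - x) e + (1 - α * τ) * (4 * α ^ 2 * ‖e‖ ^ 2) := by
      field_simp
    rw [e1]
    have e2 : 0 ≤ α * τ * (2 * α * ‖x - p‖ ^ 2) := by positivity
    have e3 : 0 ≤ (1 / 2 - α * τ) * (4 * α ^ 2 * ‖e‖ ^ 2) :=
      mul_nonneg (by linarith) (by positivity)
    linarith
  have key3 := mul_le_mul_of_nonneg_left key2 (by positivity : 0 ≤ r / 2)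
  have e4 : r * α / (1 - α * τ) = r / 2 * (2 * α / (1 - α * τ)) := by ring
  rw [h6, e4]
  linarith

/-- Crude growth bound for one step with an arbitrary step size. -/
theorem envGap_step_le_of_pos [ProperSpace E] (H : IsCompositeProblem f φ K τ fbar φbar) {α : ℝ}
    (hα : 0 < α) {x x' g : E} (hx' : x' ∈ proxSet α φ (x - α • g)) :
    envGap K τ f φ (fbar + φbar) x' ≤
      (1 + envRate K τ * (2 * α + 4)) * envGap K τ f φ (fbar + φbar) x
        + 4 * envRate K τ * α ^ 2 * ‖g‖ ^ 2 := by
  set r := envRate K τ with hr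
  have hrpos : 0 < r := H.envRate_pos
  set p := envProx K τ f φ x with hp
  have hx'S := mem_effDom_of_mem_proxSet H.proper hx'
  have hpS := H.envProx_mem x
  have h1 := toReal_proxObj_le H.weaklyConvex.1 hx' hpS
  have h2 := H.le_toReal hx'S
  have h3 := H.le_f p
  have h5 := H.envGap_le x' hpS (fbar + φbar)
  have h6 : envGap K τ f φ (fbar + φbar) x =
    f p + (φ p).toReal + r / 2 * ‖x - p‖ ^ 2 - (fbar + φbar) := rfl
  have h7 := H.norm_sub_envProx_sq_le x
  have h8 : 0 ≤ r / 2 * ‖x - p‖ ^ 2 := by positivity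
  rw [← hp] at h7
  rw [← hp, ← hr] at h5
  set V := envGap K τ f φ (fbar + φbar) x with hV
  set z := x - α • g with hz
  have h9 : ‖z - x'‖ ^ 2 ≤ 2 * α * V + ‖z - p‖ ^ 2 := by
    have h := mul_le_mul_of_nonneg_left h1 (by positivity : 0 ≤ 2 * α)
    have e1 : ∀ a t : ℝ, 2 * α * (a + α⁻¹ / 2 * t) = 2 * α * a + t := fun a t => by field_simp
    rw [e1, e1] at h
    have : 2 * α * ((φ p).toReal - (φ x').toReal) ≤ 2 * α * V :=
      mul_le_mul_of_nonneg_left (by linarith) (by positivity)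
    linarith
  have hsq : ∀ a b : E, ‖a - b‖ ^ 2 ≤ 2 * ‖a‖ ^ 2 + 2 * ‖b‖ ^ 2 := fun a b => by
    have := norm_sub_sq_real a b
    have := norm_add_sq_real a b
    nlinarith [sq_nonneg ‖a + b‖]
  have h10 : ‖x' - p‖ ^ 2 ≤ 2 * ‖z - p‖ ^ 2 + 2 * ‖z - x'‖ ^ 2 := by
    have := hsq (z - p) (z - x')
    rwa [sub_sub_sub_cancel_left] at this
  have h11 : ‖z - p‖ ^ 2 ≤ 2 * ‖x - p‖ ^ 2 + 2 * (α ^ 2 * ‖g‖ ^ 2) := by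
    have := hsq (x - p) (α • g)
    rwa [norm_smul, mul_pow, Real.norm_eq_abs, sq_abs, sub_right_comm] at this
  have h12 : ‖x' - p‖ ^ 2 ≤ (4 * α + 8) * V + 8 * (α ^ 2 * ‖g‖ ^ 2) := by linarith
  have h13 := mul_le_mul_of_nonneg_left h12 (by positivity : 0 ≤ r / 2)
  linarith

/-- Compare the proximal objective at x' with its value at x: the quadratic term ‖x - x'‖²/(2α) is
paid for by terms linear in ‖x - x'‖. This requires x ∈ dom φ, hence fails in general for the
initial point. -/
theorem norm_step_le (H : IsCompositeProblem f φ K τ fbar φbar) {α Lφ : ℝ} (hα : 0 < α)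
    (hL : ∀ y ∈ effDom φ, ∀ z ∈ effDom φ, (φ y).toReal - (φ z).toReal ≤ Lφ * ‖y - z‖)
    {x x' g : E} (hx : x ∈ effDom φ) (hx' : x' ∈ proxSet α φ (x - α • g)) :
    ‖x' - x‖ ≤ 2 * α * (|Lφ| + ‖g‖) := by
  have h1 := toReal_proxObj_le H.weaklyConvex.1 hx' hx
  have h2 := hL x hx x' (mem_effDom_of_mem_proxSet H.proper hx')
  have e1 : x - α • g - x' = (x - x') - α • g := by abel
  have e2 : x - α • g - x = - (α • g) := by abel
  rw [e1, e2, norm_neg, norm_sub_sq_real, inner_smul_right] at h1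
  have h3 := real_inner_le_norm (x - x') g
  rw [norm_sub_rev x' x]
  have h4 : Lφ * ‖x - x'‖ ≤ |Lφ| * ‖x - x'‖ :=
    mul_le_mul_of_nonneg_right (le_abs_self _) (norm_nonneg _)
  have h5 : α⁻¹ / 2 * (‖x - x'‖ ^ 2 - 2 * (α * inner ℝ (x - x') g) + ‖α • g‖ ^ 2) =
    α⁻¹ / 2 * ‖x - x'‖ ^ 2 - inner ℝ (x - x') g + α⁻¹ / 2 * ‖α • g‖ ^ 2 := by
    field_simp
  rw [h5] at h1
  have h6 : α⁻¹ / 2 * ‖x - x'‖ ^ 2 ≤ (|Lφ| + ‖g‖) * ‖x - x'‖ := by linarith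
  have h7 : ‖x - x'‖ ^ 2 ≤ 2 * α * (|Lφ| + ‖g‖) * ‖x - x'‖ := by
    have := mul_le_mul_of_nonneg_left h6 (by positivity : 0 ≤ 2 * α)
    have e3 : 2 * α * (α⁻¹ / 2 * ‖x - x'‖ ^ 2) = ‖x - x'‖ ^ 2 := by field_simp
    linarith
  rcases (norm_nonneg (x - x')).eq_or_lt with h0 | h0
  · rw [← h0]; positivity
  · refine le_of_mul_le_mul_right ?_ h0
    linarith

end IsCompositeProblem

/-! ### A deterministic convergence criterion -/

/-- If G n ≥ η at a late n, then G never again drops below η/2: while it stays above, the tail of Σ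
α G² limits the elapsed Σ α, and so the possible drop. But G ≥ η/2 forever makes Σ α finite. -/
theorem tendsto_zero_of_summable_mul_sq {G α M : ℕ → ℝ} {H l : ℝ} (hα : ∀ k, 0 < α k)
    (hsum : Summable fun k => α k * G k ^ 2) (hα' : ¬ Summable α) (hG : ∀ k, 0 ≤ G k)
    (hl : 0 ≤ l) (hstep : ∀ k, |G (k + 1) - G k| ≤ l * (H * α k + (M (k + 1) - M k)))
    (hM : ∃ c, Tendsto M atTop (𝓝 c)) : Tendsto G atTop (𝓝 0) := by
  have hsmall : ∀ η : ℝ, 0 < η → ∃ N, ∀ n ≥ N, G n < η := by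
    intro η hη
    obtain ⟨c, hc⟩ := hM
    -- ε and δ are chosen so that the fluctuation of M and the drift H Σ α each contribute at most
    -- η/8 to the drop.
    set ε := η / (8 * (l + 1)) with hε
    have hεpos : 0 < ε := by positivity
    set δ := η ^ 3 / (32 * (l * |H| + 1)) with hδ
    have hδpos : 0 < δ := by positivity
    obtain ⟨N₁, hN₁⟩ := Metric.cauchySeq_iff.1 hc.cauchySeq ε hεpos
    obtain ⟨N₂, hN₂⟩ := Metric.cauchySeq_iff.1 hsum.hasSum.tendsto_sum_nat.cauchySeq δ hδpos
    refine ⟨max N₁ N₂, fun n hn => ?_⟩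
    by_contra! hcon
    have hn1 : N₁ ≤ n := (le_max_left _ _).trans hn
    have hn2 : N₂ ≤ n := (le_max_right _ _).trans hn
    have hdrop : ∀ j, G n - G (n + j) ≤
        l * (H * ∑ i ∈ Finset.range j, α (n + i) + (M (n + j) - M n)) := by
      intro j
      induction j with
      | zero => simp
      | succ j ih =>
        have := (abs_le.1 (hstep (n + j))).1
        rw [Finset.sum_range_succ, ← add_assoc]
        linarith
    have htail : ∀ j, ∑ i ∈ Finset.range j, α (n + i) * G (n + i) ^ 2 < δ := by
      intro j
      have := hN₂ (n + j) (by omega) n hn2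
      rw [Real.dist_eq, Finset.sum_range_add, add_sub_cancel_left] at this
      exact (le_abs_self _).trans_lt this
    have hlow : ∀ j, η / 2 ≤ G (n + j) := by
      intro j
      induction j using Nat.strong_induction_on with
      | _ j ih =>
        have h1 : (η / 2) ^ 2 * ∑ i ∈ Finset.range j, α (n + i) ≤ δ := by
          refine le_trans ?_ (htail j).le
          rw [Finset.mul_sum]
          refine Finset.sum_le_sum fun i hi => ?_
          have := ih i (Finset.mem_range.1 hi)
          rw [mul_comm]
          exact mul_le_mul_of_nonneg_left (pow_le_pow_left₀ (by positivity) this 2) (hα _).le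
        have h2 : |M (n + j) - M n| < ε := by
          have := hN₁ (n + j) (by omega) n hn1
          rwa [Real.dist_eq] at this
        have h3 := hdrop j
        set A := ∑ i ∈ Finset.range j, α (n + i) with hA
        have hA0 : 0 ≤ A := Finset.sum_nonneg fun i _ => (hα _).le
        have h4 : H * A ≤ |H| * A := mul_le_mul_of_nonneg_right (le_abs_self _) hA0
        have h5 : A ≤ 4 * δ / η ^ 2 := by
          rw [le_div_iff₀ (by positivity)]
          linarith
        have h6 : l * |H| * A ≤ η / 8 := by
          have e1 : l * |H| * A ≤ (l * |H| + 1) * (4 * δ / η ^ 2) :=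
            mul_le_mul (by linarith) h5 hA0 (by positivity)
          have e2 : (l * |H| + 1) * (4 * δ / η ^ 2) = η / 8 := by
            rw [hδ]; field_simp; norm_num
          linarith
        have h7 : l * ε ≤ η / 8 := by
          have e1 : (l + 1) * ε = η / 8 := by rw [hε]; field_simp
          nlinarith
        have h8 : l * (M (n + j) - M n) ≤ l * ε :=
          mul_le_mul_of_nonneg_left ((le_abs_self _).trans h2.le) hl
        have h9 : l * (H * A) ≤ l * (|H| * A) := mul_le_mul_of_nonneg_left h4 hl
        nlinarith
    apply hα'
    have h1 : Summable fun i => α (i + n) * G (i + n) ^ 2 :=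
      (summable_nat_add_iff (f := fun k => α k * G k ^ 2) n).2 hsum
    refine (summable_nat_add_iff n).1 (Summable.of_nonneg_of_le (fun i => (hα _).le) (fun i => ?_)
      (h1.mul_left (4 / η ^ 2)))
    have h2 := hlow i
    rw [add_comm n i] at h2
    have h3 : (η / 2) ^ 2 ≤ G (i + n) ^ 2 := pow_le_pow_left₀ (by positivity) h2 2
    have h4 : α (i + n) = 4 / η ^ 2 * (α (i + n) * (η / 2) ^ 2) := by field_simp; norm_num
    rw [h4]
    refine mul_le_mul_of_nonneg_left ?_ (by positivity)
    rw [← h4]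
    exact mul_le_mul_of_nonneg_left h3 (hα _).le
  rw [Metric.tendsto_atTop]
  intro η hη
  obtain ⟨N, hN⟩ := hsmall η hη
  exact ⟨N, fun n hn => by rw [Real.dist_eq, sub_zero, abs_of_nonneg (hG n)]; exact hN n hn⟩

/-! ### Martingale tools -/

section Stochastic

variable {Ω : Type*} {mΩ : MeasurableSpace Ω} {ν : Measure Ω}

theorem ae_summable_of_summable_integral {R : ℕ → Ω → ℝ} (hR0 : ∀ k ω, 0 ≤ R k ω)
    (hR : ∀ k, Integrable (R k) ν) (hsum : Summable fun k => ∫ ω, R k ω ∂ν) :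
    ∀ᵐ ω ∂ν, Summable fun k => R k ω := by
  have h1 : ∫⁻ ω, ∑' k, ENNReal.ofReal (R k ω) ∂ν ≠ ⊤ := by
    rw [lintegral_tsum fun k => (hR k).aemeasurable.ennreal_ofReal]
    have : ∀ k, ∫⁻ ω, ENNReal.ofReal (R k ω) ∂ν = ENNReal.ofReal (∫ ω, R k ω ∂ν) := fun k =>
      (ofReal_integral_eq_lintegral_ofReal (hR k) (ae_of_all _ (hR0 k))).symm
    simp_rw [this]
    exact hsum.tsum_ofReal_ne_top
  filter_upwards [ae_lt_top' (AEMeasurable.tsum fun k =>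
    (hR k).aemeasurable.ennreal_ofReal) h1] with ω hω
  have := ENNReal.summable_toReal hω.ne
  simpa [ENNReal.toReal_ofReal, hR0] using this

theorem integral_add_sq_of_orthogonal {u d : Ω → ℝ} (hu : MemLp u 2 ν) (hd : MemLp d 2 ν)
    (h : ∫ ω, u ω * d ω ∂ν = 0) :
    ∫ ω, (u ω + d ω) ^ 2 ∂ν = ∫ ω, u ω ^ 2 ∂ν + ∫ ω, d ω ^ 2 ∂ν := by
  have i1 : Integrable (fun ω => u ω * d ω) ν := hu.integrable_mul hd
  have e : ∀ ω, (u ω + d ω) ^ 2 = u ω ^ 2 + d ω ^ 2 + 2 * (u ω * d ω) := fun ω => by ring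
  have i2 : Integrable (fun ω => u ω ^ 2 + d ω ^ 2) ν := hu.integrable_sq.add hd.integrable_sq
  simp_rw [e]
  rw [integral_add i2 (i1.const_mul 2), integral_add hu.integrable_sq hd.integrable_sq, integral_const_mul, h, mul_zero, add_zero]

variable [IsFiniteMeasure ν]

theorem setIntegral_inner_eq_zero_of_condExp {E : Type*} [NormedAddCommGroup E]
    [InnerProductSpace ℝ E] [CompleteSpace E] {m : MeasurableSpace Ω} (hm : m ≤ mΩ)
    {u e : Ω → E} (hu : StronglyMeasurable[m] u) (he : Integrable e ν)
    (hue : Integrable (fun ω => inner ℝ (u ω) (e ω)) ν) (h0 : ν[e | m] =ᵐ[ν] 0) {B : Set Ω}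
    (hB : MeasurableSet[m] B) : ∫ ω in B, inner ℝ (u ω) (e ω) ∂ν = 0 := by
  have h1 := condExp_bilin_of_stronglyMeasurable_left (μ := ν) (innerSL ℝ (E := E)) hu hue he
  rw [← setIntegral_condExp hm hue hB]
  refine setIntegral_eq_zero_of_ae_eq_zero ?_
  filter_upwards [h1, h0] with ω hω h0ω _
  refine hω.trans ?_
  simp [h0ω]

/-- A version of the Robbins–Siegmund theorem. -/
theorem robbins_siegmund {ℱ : Filtration ℕ mΩ} {V R : ℕ → Ω → ℝ} {b : ℕ → ℝ}
    (hb0 : ∀ k, 0 ≤ b k) (hb : Summable b) (hV0 : ∀ k ω, 0 ≤ V k ω)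
    (hadp : StronglyAdapted ℱ V) (hV : ∀ k, Integrable (V k) ν) (hR0 : ∀ k ω, 0 ≤ R k ω)
    (hR : ∀ k, Integrable (R k) ν)
    (hstep : ∀ k B, MeasurableSet[ℱ k] B →
      ∫ ω in B, V (k + 1) ω ∂ν ≤ ∫ ω in B, (V k ω - R k ω + b k * (V k ω + 1)) ∂ν) :
    (∃ c, ∀ k, ∫ ω, V k ω ∂ν ≤ c) ∧ (Summable fun k => ∫ ω, R k ω ∂ν) ∧
      ∀ᵐ ω ∂ν, ∃ c, ∀ k, V k ω ≤ c := by
  set β : ℕ → ℝ := fun k => ∏ i ∈ Finset.range k, (1 + b i) with hβ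
  have hβs : ∀ k, β (k + 1) = β k * (1 + b k) := fun k => Finset.prod_range_succ _ _
  have hβ1 : ∀ k, 1 ≤ β k := by
    intro k
    induction k with
    | zero => simp [hβ]
    | succ k ih => rw [hβs]; nlinarith [hb0 k]
  have hβpos : ∀ k, 0 < β k := fun k => one_pos.trans_le (hβ1 k)
  set T := Real.exp (∑' k, b k) with hT
  have hβT : ∀ k, β k ≤ T := fun k => by
    have h1 : β k ≤ Real.exp (∑ i ∈ Finset.range k, b i) := by
      rw [Real.exp_sum]
      refine Finset.prod_le_prod (fun i _ => by linarith [hb0 i]) fun i _ => ?_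
      linarith [Real.add_one_le_exp (b i)]
    exact h1.trans (Real.exp_le_exp.2 (hb.sum_le_tsum _ fun i _ => hb0 i))
  -- Adding 1 to V makes the perturbation purely multiplicative, with factor 1 + b k; dividing by
  -- the bounded products β yields a nonnegative supermartingale.
  set Y : ℕ → Ω → ℝ := fun k ω => (β k)⁻¹ * (V k ω + 1) with hY
  have hYint : ∀ k, Integrable (Y k) ν := fun k =>
    ((hV k).add (integrable_const 1)).const_mul _
  have hYadp : StronglyAdapted ℱ Y := fun k =>
    ((hadp k).add stronglyMeasurable_const).const_mul _
  have hYdesc : ∀ k B, MeasurableSet[ℱ k] B →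
      ∫ ω in B, Y (k + 1) ω ∂ν ≤ ∫ ω in B, Y k ω ∂ν - (β (k + 1))⁻¹ * ∫ ω in B, R k ω ∂ν := by
    intro k B hB
    have h1 := hstep k B hB
    have i1 := (hV k).integrableOn (s := B)
    have i2 := (hR k).integrableOn (s := B)
    have i3 := (hV (k + 1)).integrableOn (s := B)
    have i4 : IntegrableOn (fun _ => (1 : ℝ)) B ν := integrableOn_const (measure_ne_top _ _)
    have e1 : ∫ ω in B, (V k ω - R k ω + b k * (V k ω + 1)) ∂ν =
        (1 + b k) * ∫ ω in B, (V k ω + 1) ∂ν - ∫ ω in B, R k ω ∂ν - ∫ ω in B, (1 : ℝ) ∂ν := by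
      have i5 : IntegrableOn (fun ω => (1 + b k) * (V k ω + 1)) B ν := (i1.add i4).const_mul _
      have i6 : IntegrableOn (fun ω => (1 + b k) * (V k ω + 1) - R k ω) B ν := i5.sub i2
      rw [← integral_const_mul, ← integral_sub i5 i2, ← integral_sub i6 i4]
      refine integral_congr_ae (ae_of_all _ fun ω => ?_)
      ring
    have e2 : ∫ ω in B, (V (k + 1) ω + 1) ∂ν =
      ∫ ω in B, V (k + 1) ω ∂ν + ∫ ω in B, (1 : ℝ) ∂ν := integral_add i3 i4
    have e3 : (β (k + 1))⁻¹ * (1 + b k) = (β k)⁻¹ := by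
      rw [hβs]
      have := (hβpos k).ne'
      have : 1 + b k ≠ 0 := by linarith [hb0 k]
      field_simp
    simp only [hY, integral_const_mul]
    rw [← e3, mul_assoc, ← mul_sub]
    refine mul_le_mul_of_nonneg_left ?_ (inv_nonneg.2 (hβpos _).le)
    rw [e2]
    linarith
  have hYsuper : Supermartingale Y ℱ ν := by
    refine supermartingale_of_setIntegral_succ_le hYadp hYint fun k B hB => ?_
    refine (hYdesc k B hB).trans (sub_le_self _ ?_)
    exact mul_nonneg (inv_nonneg.2 (hβpos _).le) (integral_nonneg (hR0 k))
  have hYdesc' : ∀ k, ∫ ω, R k ω ∂ν ≤ T * (∫ ω, Y k ω ∂ν - ∫ ω, Y (k + 1) ω ∂ν) := by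
    intro k
    have := hYdesc k Set.univ MeasurableSet.univ
    simp only [setIntegral_univ] at this
    have hRk : 0 ≤ ∫ ω, R k ω ∂ν := integral_nonneg (hR0 k)
    have h2 : ∫ ω, R k ω ∂ν ≤ β (k + 1) * (∫ ω, Y k ω ∂ν - ∫ ω, Y (k + 1) ω ∂ν) := by
      rw [← inv_mul_le_iff₀ (hβpos _)]
      linarith
    have h3 : 0 ≤ ∫ ω, Y k ω ∂ν - ∫ ω, Y (k + 1) ω ∂ν := by
      have : 0 ≤ (β (k + 1))⁻¹ * ∫ ω, R k ω ∂ν :=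
        mul_nonneg (inv_nonneg.2 (hβpos _).le) hRk
      linarith
    exact h2.trans (mul_le_mul_of_nonneg_right (hβT _) h3)
  have hY0 : ∀ k ω, 0 ≤ Y k ω := fun k ω =>
    mul_nonneg (inv_nonneg.2 (hβpos _).le) (by linarith [hV0 k ω])
  have hTpos : 0 < T := Real.exp_pos _
  have hYmono : ∀ k, ∫ ω, Y k ω ∂ν ≤ ∫ ω, Y 0 ω ∂ν := by
    intro k
    induction k with
    | zero => rfl
    | succ k ih =>
      refine le_trans ?_ ih
      have h1 := hYdesc' k
      have h2 : 0 ≤ ∫ ω, R k ω ∂ν := integral_nonneg (hR0 k)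
      have := nonneg_of_mul_nonneg_right (h2.trans h1) hTpos
      linarith
  have hVY : ∀ k ω, V k ω ≤ T * Y k ω := fun k ω => by
    have h1 : β k * Y k ω = V k ω + 1 := by
      simp only [hY]
      rw [mul_inv_cancel_left₀ (hβpos k).ne']
    have := mul_le_mul_of_nonneg_right (hβT k) (hY0 k ω)
    linarith
  refine ⟨⟨T * ∫ ω, Y 0 ω ∂ν, fun k => ?_⟩, ?_, ?_⟩
  · refine (integral_mono (hV k) ((hYint k).const_mul T) (hVY k)).trans ?_
    rw [integral_const_mul]
    exact mul_le_mul_of_nonneg_left (hYmono k) hTpos.le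
  · refine summable_of_sum_range_le (c := T * ∫ ω, Y 0 ω ∂ν) (fun k => integral_nonneg (hR0 k))
      fun n => ?_
    have h1 : ∑ i ∈ Finset.range n, ∫ ω, R i ω ∂ν ≤
        T * (∫ ω, Y 0 ω ∂ν - ∫ ω, Y n ω ∂ν) := by
      induction n with
      | zero => simp
      | succ n ih =>
        rw [Finset.sum_range_succ]
        have := hYdesc' n
        linarith
    refine h1.trans (mul_le_mul_of_nonneg_left ?_ hTpos.le)
    linarith [integral_nonneg (μ := ν) (f := Y n) (hY0 n)]
  · have hbdd : ∀ n, eLpNorm ((-Y) n) 1 ν ≤ ((∫ ω, Y 0 ω ∂ν).toNNReal : ENNReal) := by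
      intro n
      rw [Pi.neg_apply, eLpNorm_neg, eLpNorm_one_eq_lintegral_enorm]
      have : ∫⁻ ω, ‖Y n ω‖ₑ ∂ν = ENNReal.ofReal (∫ ω, Y n ω ∂ν) := by
        rw [ofReal_integral_eq_lintegral_ofReal (hYint n) (ae_of_all _ (hY0 n))]
        exact lintegral_congr fun ω => Real.enorm_of_nonneg (hY0 n ω)
      rw [this]
      exact ENNReal.ofReal_le_ofReal (hYmono n)
    filter_upwards [hYsuper.neg.exists_ae_tendsto_of_bdd hbdd] with ω hω
    obtain ⟨c, hc⟩ := hω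
    obtain ⟨d, hd⟩ := hc.neg.bddAbove_range
    refine ⟨T * d, fun k => (hVY k ω).trans (mul_le_mul_of_nonneg_left ?_ hTpos.le)⟩
    have := hd ⟨k, rfl⟩
    simpa using this

/-- Increments with summable second moments are summable up to their conditional means. -/
theorem exists_ae_tendsto_compensated {ℱ : Filtration ℕ mΩ} {w H : ℕ → Ω → ℝ} {a : ℕ → ℝ}
    (hw : ∀ k, StronglyMeasurable[ℱ (k + 1)] (w k)) (hw2 : ∀ k, MemLp (w k) 2 ν)
    (ha : Summable a) (hwa : ∀ k, ∫ ω, w k ω ^ 2 ∂ν ≤ a k)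
    (hH : ∀ k, StronglyMeasurable[ℱ k] (H k)) (hHint : ∀ k, Integrable (H k) ν)
    (hwH : ∀ k B, MeasurableSet[ℱ k] B → ∫ ω in B, w k ω ∂ν ≤ ∫ ω in B, H k ω ∂ν) :
    ∀ᵐ ω ∂ν, ∃ M : ℕ → ℝ, (∃ c, Tendsto M atTop (𝓝 c)) ∧
      ∀ k, w k ω ≤ H k ω + (M (k + 1) - M k) := by
  have hwint : ∀ k, Integrable (w k) ν := fun k => (hw2 k).integrable one_le_two
  set c : ℕ → Ω → ℝ := fun k => ν[w k | ℱ k] with hc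
  have hc2 : ∀ k, MemLp (c k) 2 ν := fun k => (hw2 k).condExp one_le_two
  have hcint : ∀ k, Integrable (c k) ν := fun k => (hc2 k).integrable one_le_two
  have hcm : ∀ k, StronglyMeasurable[ℱ k] (c k) := fun k => stronglyMeasurable_condExp
  have hcH : ∀ k, c k ≤ᵐ[ν] H k := by
    intro k
    refine ae_le_of_ae_le_trim (hm := ℱ.le k) ?_
    refine ae_le_of_forall_setIntegral_le ((hcint k).trim (ℱ.le k) (hcm k))
      ((hHint k).trim (ℱ.le k) (hH k)) fun B hB _ => ?_
    rw [← setIntegral_trim (ℱ.le k) (hcm k) hB, ← setIntegral_trim (ℱ.le k) (hH k) hB,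
      setIntegral_condExp (ℱ.le k) (hwint k) hB]
    exact hwH k B hB
  -- The centred increments are orthogonal to the past and satisfy ∫ d² ≤ ∫ w² ≤ a, so their partial
  -- sums form an L²-bounded martingale.
  set d : ℕ → Ω → ℝ := fun k => w k - c k with hd
  have hd2 : ∀ k, MemLp (d k) 2 ν := fun k => (hw2 k).sub (hc2 k)
  have hdint : ∀ k, Integrable (d k) ν := fun k => (hwint k).sub (hcint k)
  have hdm : ∀ k, StronglyMeasurable[ℱ (k + 1)] (d k) := fun k =>
    (hw k).sub ((hcm k).mono (ℱ.mono k.le_succ))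
  have hd0 : ∀ k, ν[d k | ℱ k] =ᵐ[ν] 0 := by
    intro k
    refine (condExp_sub (hwint k) (hcint k) _).trans ?_
    rw [condExp_of_stronglyMeasurable (ℱ.le k) (hcm k) (hcint k), hc, sub_self]
  have horth : ∀ k (u : Ω → ℝ), StronglyMeasurable[ℱ k] u → MemLp u 2 ν →
      ∫ ω, u ω * d k ω ∂ν = 0 := by
    intro k u hu hu2
    have hint : Integrable (fun ω => u ω * d k ω) ν := hu2.integrable_mul (hd2 k)
    have := setIntegral_inner_eq_zero_of_condExp (ℱ.le k) hu (hdint k)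
      (by simpa [mul_comm] using hint) (hd0 k) MeasurableSet.univ
    rw [setIntegral_univ] at this
    simpa [mul_comm] using this
  have hda : ∀ k, ∫ ω, d k ω ^ 2 ∂ν ≤ a k := by
    intro k
    refine le_trans ?_ (hwa k)
    have h1 : ∫ ω, w k ω ^ 2 ∂ν = ∫ ω, c k ω ^ 2 ∂ν + ∫ ω, d k ω ^ 2 ∂ν := by
      rw [← integral_add_sq_of_orthogonal (hc2 k) (hd2 k) (horth k _ (hcm k) (hc2 k))]
      simp [hd]
    rw [h1]
    exact le_add_of_nonneg_left (integral_nonneg fun ω => sq_nonneg (c k ω))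
  set M : ℕ → Ω → ℝ := fun n => ∑ i ∈ Finset.range n, d i with hMdef
  have hM2 : ∀ n, MemLp (M n) 2 ν := fun n => memLp_finsetSum' _ fun i _ => hd2 i
  have hMadp : StronglyAdapted ℱ M := fun n =>
    Finset.stronglyMeasurable_sum _ fun i hi =>
      (hdm i).mono (ℱ.mono (Finset.mem_range.1 hi))
  have hMs : ∀ n, M (n + 1) = M n + d n := fun n => Finset.sum_range_succ _ _
  have hMmart : Martingale M ℱ ν := by
    refine martingale_nat hMadp (fun n => (hM2 n).integrable one_le_two) fun n => ?_
    rw [hMs]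
    refine EventuallyEq.symm ((condExp_add ((hM2 n).integrable one_le_two) (hdint n) _).trans ?_)
    rw [condExp_of_stronglyMeasurable (ℱ.le n) (hMadp n) ((hM2 n).integrable one_le_two)]
    filter_upwards [hd0 n] with ω hω
    simp [hω]
  have hMsq : ∀ n, ∫ ω, M n ω ^ 2 ∂ν ≤ ∑ i ∈ Finset.range n, a i := by
    intro n
    induction n with
    | zero => simp [hMdef]
    | succ n ih =>
      have h1 := integral_add_sq_of_orthogonal (hM2 n) (hd2 n) (horth n _ (hMadp n) (hM2 n))
      rw [hMs, Finset.sum_range_succ]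
      simp only [Pi.add_apply]
      linarith [hda n]
  have ha0 : ∀ k, 0 ≤ a k := fun k =>
    (integral_nonneg (fun ω => sq_nonneg (w k ω))).trans (hwa k)
  have hM1 : ∀ n, ∫ ω, |M n ω| ∂ν ≤ ν.real Set.univ + ∑' k, a k := by
    intro n
    have h1 : ∫ ω, |M n ω| ∂ν ≤ ∫ ω, (1 + M n ω ^ 2) ∂ν := by
      refine integral_mono ((hM2 n).integrable one_le_two).abs
        ((integrable_const 1).add (hM2 n).integrable_sq) fun ω => ?_
      have := sq_abs (M n ω)
      dsimp only
      nlinarith [sq_nonneg (|M n ω| - 1)]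
    rw [integral_add (integrable_const 1) (hM2 n).integrable_sq, integral_const, smul_eq_mul,
      mul_one] at h1
    linarith [hMsq n, ha.sum_le_tsum (Finset.range n) fun i _ => ha0 i]
  have hbdd : ∀ n, eLpNorm (M n) 1 ν ≤
      ((ν.real Set.univ + ∑' k, a k).toNNReal : ENNReal) := by
    intro n
    have hi := (hM2 n).integrable one_le_two
    rw [eLpNorm_one_eq_lintegral_enorm, ← ofReal_integral_norm_eq_lintegral_enorm hi]
    exact ENNReal.ofReal_le_ofReal (hM1 n)
  have hall : ∀ᵐ ω ∂ν, ∀ k, c k ω ≤ H k ω := ae_all_iff.2 hcH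
  filter_upwards [hMmart.submartingale.exists_ae_tendsto_of_bdd hbdd, hall] with ω hω hω'
  refine ⟨fun n => M n ω, hω, fun k => ?_⟩
  have : M (k + 1) ω - M k ω = w k ω - c k ω := by
    rw [hMs]; simp [hd]
  rw [this]
  linarith [hω' k]

end Stochastic

/-! ### Conditional estimates along prox-SGD -/

/-- The stochastic setting of prox-SGD; the variance bound is stated on the sets of the
filtration, so that it passes to restricted measures. -/
structure IsProxSGD {E : Type*} [NormedAddCommGroup E] [InnerProductSpace ℝ E] [CompleteSpace E]
    {Ω : Type*} {mΩ : MeasurableSpace Ω} (ν : Measure Ω) (ℱ : Filtration ℕ mΩ)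
    (f : E → ℝ) (φ : E → EReal) (K τ fbar φbar : ℝ) (x g : ℕ → Ω → E) (α : ℕ → ℝ) (C D : ℝ) :
    Prop extends IsCompositeProblem f φ K τ fbar φbar where
  step_pos : ∀ k, 0 < α k
  adapted : StronglyAdapted ℱ x
  mem_proxSet : ∀ k, ∀ᵐ ω ∂ν, x (k + 1) ω ∈ proxSet (α k) φ (x k ω - α k • g k ω)
  integrable : ∀ k, Integrable (g k) ν
  unbiased : ∀ k, ν[g k | ℱ k] =ᵐ[ν] fun ω => gradient f (x k ω)
  C_nonneg : 0 ≤ C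
  D_nonneg : 0 ≤ D
  variance_le : ∀ k B, MeasurableSet[ℱ k] B →
    ∫⁻ ω in B, ‖g k ω - gradient f (x k ω)‖ₑ ^ 2 ∂ν
      ≤ ∫⁻ ω in B, ENNReal.ofReal (C * (f (x k ω) - fbar) + D) ∂ν

/-- The filtration `k ↦ ℱ (k + N)`. -/
def MeasureTheory.Filtration.shift {Ω : Type*} {mΩ : MeasurableSpace Ω} (ℱ : Filtration ℕ mΩ)
    (N : ℕ) : Filtration ℕ mΩ where
  seq k := ℱ (k + N)
  mono' _ _ hij := ℱ.mono (Nat.add_le_add_right hij N)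
  le' k := ℱ.le (k + N)

namespace IsProxSGD

variable {E : Type*} [NormedAddCommGroup E] [InnerProductSpace ℝ E] [CompleteSpace E]
  {Ω : Type*} {mΩ : MeasurableSpace Ω} {ν : Measure Ω} {ℱ : Filtration ℕ mΩ}
  {f : E → ℝ} {φ : E → EReal} {K τ fbar φbar : ℝ} {x g : ℕ → Ω → E} {α : ℕ → ℝ} {C D : ℝ}

theorem shift (h : IsProxSGD ν ℱ f φ K τ fbar φbar x g α C D) (N : ℕ) :
    IsProxSGD ν (ℱ.shift N) f φ K τ fbar φbar (fun k => x (k + N)) (fun k => g (k + N))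
      (fun k => α (k + N)) C D where
  toIsCompositeProblem := h.toIsCompositeProblem
  step_pos k := h.step_pos (k + N)
  adapted k := h.adapted (k + N)
  mem_proxSet k := by
    have := h.mem_proxSet (k + N)
    rwa [show k + N + 1 = k + 1 + N by omega] at this
  integrable k := h.integrable (k + N)
  unbiased k := h.unbiased (k + N)
  C_nonneg := h.C_nonneg
  D_nonneg := h.D_nonneg
  variance_le k := h.variance_le (k + N)

/-- Localization: an event in ℱ 0 belongs to every ℱ k, so conditioning commutes with restriction to
it. It serves to truncate V(x^0). -/
theorem restrict [IsFiniteMeasure ν] (h : IsProxSGD ν ℱ f φ K τ fbar φbar x g α C D) {A : Set Ω}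
    (hA : MeasurableSet[ℱ 0] A) :
    IsProxSGD (ν.restrict A) ℱ f φ K τ fbar φbar x g α C D where
  toIsCompositeProblem := h.toIsCompositeProblem
  step_pos := h.step_pos
  adapted := h.adapted
  mem_proxSet k := ae_restrict_of_ae (h.mem_proxSet k)
  integrable k := (h.integrable k).restrict
  unbiased k := by
    have hA' : MeasurableSet[ℱ k] A := ℱ.mono (Nat.zero_le k) _ hA
    exact (condExp_restrict_ae_eq_restrict (ℱ.le k) hA' (h.integrable k)).trans
      (ae_restrict_of_ae (h.unbiased k))
  C_nonneg := h.C_nonneg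
  D_nonneg := h.D_nonneg
  variance_le k B hB := by
    have hA' : MeasurableSet[ℱ k] A := ℱ.mono (Nat.zero_le k) _ hA
    rw [Measure.restrict_restrict (ℱ.le k _ hB)]
    exact h.variance_le k _ (hB.inter hA')

theorem ae_mem_effDom (h : IsProxSGD ν ℱ f φ K τ fbar φbar x g α C D) (k : ℕ) :
    ∀ᵐ ω ∂ν, x (k + 1) ω ∈ effDom φ := by
  filter_upwards [h.mem_proxSet k] with ω hω using mem_effDom_of_mem_proxSet h.proper hω

theorem stronglyMeasurable_gradient (h : IsProxSGD ν ℱ f φ K τ fbar φbar x g α C D) (k : ℕ) :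
    StronglyMeasurable[ℱ k] fun ω => gradient f (x k ω) :=
  h.continuous_gradient.comp_stronglyMeasurable (h.adapted k)

theorem integrable_noise (h : IsProxSGD ν ℱ f φ K τ fbar φbar x g α C D) (k : ℕ) :
    Integrable (fun ω => g k ω - gradient f (x k ω)) ν :=
  (h.integrable k).sub (integrable_condExp.congr (h.unbiased k))

theorem condExp_noise [IsFiniteMeasure ν] (h : IsProxSGD ν ℱ f φ K τ fbar φbar x g α C D) (k : ℕ) :
    ν[fun ω => g k ω - gradient f (x k ω) | ℱ k] =ᵐ[ν] 0 := by
  have hi : Integrable (fun ω => gradient f (x k ω)) ν := integrable_condExp.congr (h.unbiased k)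
  refine (condExp_sub (h.integrable k) hi _).trans ?_
  rw [condExp_of_stronglyMeasurable (ℱ.le k) (h.stronglyMeasurable_gradient k) hi]
  filter_upwards [h.unbiased k] with ω hω
  simp [hω]

/-- After finitely many steps, the step sizes are small. -/
theorem exists_small_step (h : IsProxSGD ν ℱ f φ K τ fbar φbar x g α C D)
    (hsq : Summable fun k => α k ^ 2) :
    ∃ N, ∀ k, α (k + (N + 1)) * (2 * K + envRate K τ) ≤ 1 / 2 := by
  have hc : 0 < 2 * K + envRate K τ := by linarith [h.envRate_pos, h.pos]
  have h1 := hsq.tendsto_atTop_zero.sqrt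
  rw [Real.sqrt_zero] at h1
  simp only [Real.sqrt_sq (h.step_pos _).le] at h1
  have h2 := h1.mul_const (2 * K + envRate K τ)
  rw [zero_mul] at h2
  obtain ⟨N, hN⟩ := eventually_atTop.1 (h2.eventually_le_const (by norm_num : (0 : ℝ) < 1 / 2))
  exact ⟨N, fun k => hN _ (by omega)⟩

variable [ProperSpace E]

theorem stronglyMeasurable_envProx (h : IsProxSGD ν ℱ f φ K τ fbar φbar x g α C D) (k : ℕ) :
    StronglyMeasurable[ℱ k] fun ω => envProx K τ f φ (x k ω) :=
  h.continuous_envProx.comp_stronglyMeasurable (h.adapted k)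

theorem stronglyMeasurable_envGap (h : IsProxSGD ν ℱ f φ K τ fbar φbar x g α C D) (k : ℕ) :
    StronglyMeasurable[ℱ k] fun ω => envGap K τ f φ (fbar + φbar) (x k ω) := by
  borelize E
  exact ((h.measurable_envGap _).comp (h.adapted k).measurable).stronglyMeasurable

theorem stronglyMeasurable_natRes (h : IsProxSGD ν ℱ f φ K τ fbar φbar x g α C D) {lam : ℝ}
    (hlam : 0 < lam) (hlt : lam * τ < 1) (k : ℕ) :
    StronglyMeasurable[ℱ k] fun ω => natRes lam f φ (x k ω) := by
  have hc : 0 < lam⁻¹ - τ := by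
    rw [sub_pos, ← one_div, lt_div_iff₀ hlam]
    linarith
  have hl : 0 ≤ 1 + (lam⁻¹ + K) / (lam⁻¹ - τ) := by
    have := h.pos
    positivity
  have : LipschitzWith (Real.toNNReal (1 + (lam⁻¹ + K) / (lam⁻¹ - τ))) (natRes lam f φ) :=
    LipschitzWith.of_dist_le_mul fun y z => by
      rw [dist_eq_norm, dist_eq_norm, Real.coe_toNNReal _ hl]
      exact h.norm_natRes_sub_le hlam hlt y z
  exact this.continuous.comp_stronglyMeasurable (h.adapted k)

theorem memLp_sub_envProx (h : IsProxSGD ν ℱ f φ K τ fbar φbar x g α C D) {k : ℕ}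
    (hV : Integrable (fun ω => envGap K τ f φ (fbar + φbar) (x k ω)) ν) :
    MemLp (fun ω => envProx K τ f φ (x k ω) - x k ω) 2 ν := by
  have hm : AEStronglyMeasurable (fun ω => envProx K τ f φ (x k ω) - x k ω) ν :=
    (((h.stronglyMeasurable_envProx k).sub (h.adapted k)).mono (ℱ.le k)).aestronglyMeasurable
  rw [memLp_two_iff_integrable_sq_norm hm]
  refine hV.mono' (hm.norm.pow 2) (ae_of_all _ fun ω => ?_)
  rw [Real.norm_of_nonneg (sq_nonneg _), norm_sub_rev]
  exact h.norm_sub_envProx_sq_le _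

variable [IsFiniteMeasure ν]

theorem integrable_noise_sq (h : IsProxSGD ν ℱ f φ K τ fbar φbar x g α C D) {k : ℕ}
    (hV : Integrable (fun ω => envGap K τ f φ (fbar + φbar) (x k ω)) ν) :
    Integrable (fun ω => ‖g k ω - gradient f (x k ω)‖ ^ 2) ν ∧
      ∀ B, MeasurableSet[ℱ k] B → ∫ ω in B, ‖g k ω - gradient f (x k ω)‖ ^ 2 ∂ν ≤
        ∫ ω in B, (2 * C * envGap K τ f φ (fbar + φbar) (x k ω) + D) ∂ν := by
  have hC := h.C_nonneg
  have hD := h.D_nonneg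
  have hW : Integrable (fun ω => 2 * C * envGap K τ f φ (fbar + φbar) (x k ω) + D) ν :=
    (hV.const_mul (2 * C)).add (integrable_const D)
  have hW0 : ∀ ω, 0 ≤ 2 * C * envGap K τ f φ (fbar + φbar) (x k ω) + D := fun ω => by
    have := h.envGap_nonneg (x k ω)
    positivity
  have hle : ∀ B, MeasurableSet[ℱ k] B → ∫⁻ ω in B, ‖g k ω - gradient f (x k ω)‖ₑ ^ 2 ∂ν ≤
      ENNReal.ofReal (∫ ω in B, (2 * C * envGap K τ f φ (fbar + φbar) (x k ω) + D) ∂ν) := by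
    intro B hB
    rw [ofReal_integral_eq_lintegral_ofReal hW.integrableOn (ae_of_all _ hW0)]
    refine (h.variance_le k B hB).trans (lintegral_mono fun ω => ENNReal.ofReal_le_ofReal ?_)
    have := mul_le_mul_of_nonneg_left (h.f_sub_le_envGap (x k ω)) hC
    linarith
  have hen : ∀ ω, ‖‖g k ω - gradient f (x k ω)‖ ^ 2‖ₑ = ‖g k ω - gradient f (x k ω)‖ₑ ^ 2 := by
    intro ω
    rw [enorm_pow, enorm_norm]
  have hint : Integrable (fun ω => ‖g k ω - gradient f (x k ω)‖ ^ 2) ν := by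
    refine ⟨(h.integrable_noise k).1.norm.pow 2, ?_⟩
    unfold HasFiniteIntegral
    simp_rw [hen]
    have := hle Set.univ MeasurableSet.univ
    rw [Measure.restrict_univ] at this
    exact this.trans_lt ENNReal.ofReal_lt_top
  refine ⟨hint, fun B hB => ?_⟩
  rw [← ENNReal.ofReal_le_ofReal_iff (integral_nonneg hW0)]
  refine le_trans (le_of_eq ?_) (hle B hB)
  rw [ofReal_integral_eq_lintegral_ofReal hint.integrableOn (ae_of_all _ fun ω => sq_nonneg _)]
  refine lintegral_congr fun ω => ?_
  rw [← hen, Real.enorm_of_nonneg (sq_nonneg _)]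

/-- The crude growth bound suffices here; it carries integrability through the initial steps, where
α_k may be too large for the descent estimate. -/
theorem integrable_envGap_succ (h : IsProxSGD ν ℱ f φ K τ fbar φbar x g α C D) {k : ℕ}
    (hV : Integrable (fun ω => envGap K τ f φ (fbar + φbar) (x k ω)) ν) :
    Integrable (fun ω => envGap K τ f φ (fbar + φbar) (x (k + 1) ω)) ν := by
  have hr := h.envRate_pos
  have hK := h.pos
  have he := (h.integrable_noise_sq hV).1
  refine Integrable.mono' (((hV.const_mul (1 + envRate K τ * (2 * α k + 4)))).add
    ((((he.const_mul 2).add (hV.const_mul (16 * K)))).const_mul (4 * envRate K τ * α k ^ 2)))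
    ((h.stronglyMeasurable_envGap (k + 1)).mono (ℱ.le _)).aestronglyMeasurable ?_
  filter_upwards [h.mem_proxSet k] with ω hω
  rw [Real.norm_of_nonneg (h.envGap_nonneg _)]
  refine (h.envGap_step_le_of_pos (h.step_pos k) hω).trans ?_
  simp only [Pi.add_apply]
  gcongr
  have h1 := norm_gradient_sq_le h.differentiable h.pos h.lipschitz h.le_f (x k ω)
  have h2 := mul_le_mul_of_nonneg_left (h.f_sub_le_envGap (x k ω))
    (by positivity : 0 ≤ 4 * K)
  have h3 : ‖g k ω‖ ≤ ‖g k ω - gradient f (x k ω)‖ + ‖gradient f (x k ω)‖ := by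
    simpa using norm_add_le (g k ω - gradient f (x k ω)) (gradient f (x k ω))
  have h4 : ‖g k ω‖ ^ 2 ≤ (‖g k ω - gradient f (x k ω)‖ + ‖gradient f (x k ω)‖) ^ 2 :=
    pow_le_pow_left₀ (norm_nonneg _) h3 2
  nlinarith [sq_nonneg (‖g k ω - gradient f (x k ω)‖ - ‖gradient f (x k ω)‖)]

theorem integrable_envGap (h : IsProxSGD ν ℱ f φ K τ fbar φbar x g α C D)
    (hV : Integrable (fun ω => envGap K τ f φ (fbar + φbar) (x 0 ω)) ν) (k : ℕ) :
    Integrable (fun ω => envGap K τ f φ (fbar + φbar) (x k ω)) ν := by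
  induction k with
  | zero => exact hV
  | succ k ih => exact h.integrable_envGap_succ ih

theorem setIntegral_envGap_succ_le (h : IsProxSGD ν ℱ f φ K τ fbar φbar x g α C D) {k : ℕ}
    (hV : Integrable (fun ω => envGap K τ f φ (fbar + φbar) (x k ω)) ν)
    (hα : α k * (2 * K + envRate K τ) ≤ 1 / 2) {B : Set Ω} (hB : MeasurableSet[ℱ k] B) :
    ∫ ω in B, envGap K τ f φ (fbar + φbar) (x (k + 1) ω) ∂ν ≤
      ∫ ω in B, (envGap K τ f φ (fbar + φbar) (x k ω)
        - envRate K τ * α k * ‖x k ω - envProx K τ f φ (x k ω)‖ ^ 2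
        + 2 * envRate K τ * (2 * C + D) * α k ^ 2
          * (envGap K τ f φ (fbar + φbar) (x k ω) + 1)) ∂ν := by
  have hr := h.envRate_pos
  have hC := h.C_nonneg
  have hD := h.D_nonneg
  obtain ⟨he, heB⟩ := h.integrable_noise_sq hV
  have hp2 := h.memLp_sub_envProx hV
  have he2 : MemLp (fun ω => g k ω - gradient f (x k ω)) 2 ν := by
    rwa [memLp_two_iff_integrable_sq_norm (h.integrable_noise k).1]
  have hu : StronglyMeasurable[ℱ k] fun ω => envProx K τ f φ (x k ω) - x k ω :=
    (h.stronglyMeasurable_envProx k).sub (h.adapted k)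
  have hin : Integrable (fun ω => inner ℝ (envProx K τ f φ (x k ω) - x k ω)
      (g k ω - gradient f (x k ω))) ν := by
    refine (hp2.norm.integrable_mul he2.norm).mono'
      (hp2.1.inner he2.1) (ae_of_all _ fun ω => ?_)
    exact norm_inner_le_norm _ _
  have h0 := setIntegral_inner_eq_zero_of_condExp (ℱ.le k) hu (h.integrable_noise k) hin
    (h.condExp_noise k) hB
  have hres : Integrable (fun ω => envRate K τ * α k * ‖x k ω - envProx K τ f φ (x k ω)‖ ^ 2) ν := by
    have := hp2.integrable_norm_pow two_ne_zero
    simp only [norm_sub_rev (envProx K τ f φ _)] at this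
    exact (by simpa using this : Integrable (fun ω => ‖x k ω - envProx K τ f φ (x k ω)‖ ^ 2) ν).const_mul _
  have hA : Integrable (fun ω => envGap K τ f φ (fbar + φbar) (x k ω)
        - envRate K τ * α k * ‖x k ω - envProx K τ f φ (x k ω)‖ ^ 2) ν := hV.sub hres
  set γ := envRate K τ * α k / (1 - α k * τ) with hγ
  have hG : Integrable (fun ω => γ * inner ℝ (envProx K τ f φ (x k ω) - x k ω)
      (g k ω - gradient f (x k ω))) ν := hin.const_mul _
  have hN : Integrable (fun ω => 2 * envRate K τ * α k ^ 2 *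
      ‖g k ω - gradient f (x k ω)‖ ^ 2) ν := he.const_mul _
  have hAG : Integrable (fun ω => envGap K τ f φ (fbar + φbar) (x k ω)
        - envRate K τ * α k * ‖x k ω - envProx K τ f φ (x k ω)‖ ^ 2
        + γ * inner ℝ (envProx K τ f φ (x k ω) - x k ω) (g k ω - gradient f (x k ω))) ν :=
    hA.add hG
  have h1 : ∫ ω in B, envGap K τ f φ (fbar + φbar) (x (k + 1) ω) ∂ν ≤
      ∫ ω in B, (envGap K τ f φ (fbar + φbar) (x k ω)
        - envRate K τ * α k * ‖x k ω - envProx K τ f φ (x k ω)‖ ^ 2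
        + γ * inner ℝ (envProx K τ f φ (x k ω) - x k ω) (g k ω - gradient f (x k ω))
        + 2 * envRate K τ * α k ^ 2 * ‖g k ω - gradient f (x k ω)‖ ^ 2) ∂ν := by
    refine integral_mono_ae (h.integrable_envGap_succ hV).integrableOn
      (hAG.add hN).integrableOn (ae_restrict_of_ae ?_)
    filter_upwards [h.mem_proxSet k] with ω hω
    exact h.envGap_step_le (h.step_pos k) hα hω
  rw [integral_add hAG.integrableOn hN.integrableOn, integral_add hA.integrableOn hG.integrableOn,
    integral_const_mul, integral_const_mul, h0, mul_zero, add_zero] at h1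
  have hV1 : Integrable (fun ω => 2 * envRate K τ * (2 * C + D) * α k ^ 2
      * (envGap K τ f φ (fbar + φbar) (x k ω) + 1)) ν :=
    (hV.add (integrable_const 1)).const_mul _
  rw [integral_add hA.integrableOn hV1.integrableOn]
  refine h1.trans (add_le_add le_rfl ?_)
  have hr2 : 0 ≤ 2 * envRate K τ * α k ^ 2 := by positivity
  refine (mul_le_mul_of_nonneg_left (heB B hB) hr2).trans ?_
  rw [← integral_const_mul]
  refine integral_mono ((((hV.const_mul (2 * C)).add (integrable_const D)).const_mul _).integrableOn)
    hV1.integrableOn fun ω => ?_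
  have hV0 := h.envGap_nonneg (x k ω)
  -- This is the slack in 2CV + D ≤ (2C + D)(V + 1).
  have : 0 ≤ 2 * envRate K τ * α k ^ 2 * (2 * C + D * envGap K τ f φ (fbar + φbar) (x k ω)) := by
    positivity
  dsimp only
  linarith

theorem memLp_increment (h : IsProxSGD ν ℱ f φ K τ fbar φbar x g α C D) {Lφ : ℝ}
    (hL : ∀ y ∈ effDom φ, ∀ z ∈ effDom φ, (φ y).toReal - (φ z).toReal ≤ Lφ * ‖y - z‖) {k : ℕ}
    (hx : ∀ᵐ ω ∂ν, x k ω ∈ effDom φ)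
    (hV : Integrable (fun ω => envGap K τ f φ (fbar + φbar) (x k ω)) ν) :
    MemLp (fun ω => ‖x (k + 1) ω - x k ω‖) 2 ν ∧ ∀ B, MeasurableSet[ℱ k] B →
      ∫ ω in B, ‖x (k + 1) ω - x k ω‖ ^ 2 ∂ν ≤ ∫ ω in B, (α k ^ 2 *
        (12 * (Lφ ^ 2 + 2 * C + D + 8 * K) *
          (envGap K τ f φ (fbar + φbar) (x k ω) + 1))) ∂ν := by
  have hC := h.C_nonneg
  have hD := h.D_nonneg
  have hK := h.pos
  obtain ⟨he, heB⟩ := h.integrable_noise_sq hV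
  have hm : AEStronglyMeasurable (fun ω => ‖x (k + 1) ω - x k ω‖) ν :=
    ((((h.adapted (k + 1)).mono (ℱ.le _)).sub ((h.adapted k).mono (ℱ.le _))).norm).aestronglyMeasurable
  have hY : Integrable (fun ω => Lφ ^ 2 + 8 * K * envGap K τ f φ (fbar + φbar) (x k ω)) ν :=
    (integrable_const (Lφ ^ 2)).add (hV.const_mul _)
  have hZ : Integrable (fun ω => 12 * α k ^ 2 * (Lφ ^ 2 + 8 * K *
      envGap K τ f φ (fbar + φbar) (x k ω) + ‖g k ω - gradient f (x k ω)‖ ^ 2)) ν :=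
    (hY.add he).const_mul _
  have hle : ∀ᵐ ω ∂ν, ‖x (k + 1) ω - x k ω‖ ^ 2 ≤ 12 * α k ^ 2 * (Lφ ^ 2 + 8 * K *
      envGap K τ f φ (fbar + φbar) (x k ω) + ‖g k ω - gradient f (x k ω)‖ ^ 2) := by
    filter_upwards [hx, h.mem_proxSet k] with ω hω hω'
    have h1 := h.norm_step_le (h.step_pos k) hL hω hω'
    have h3 : ‖g k ω‖ ≤ ‖g k ω - gradient f (x k ω)‖ + ‖gradient f (x k ω)‖ := by
      simpa using norm_add_le (g k ω - gradient f (x k ω)) (gradient f (x k ω))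
    have h4 := norm_gradient_sq_le h.differentiable h.pos h.lipschitz h.le_f (x k ω)
    have h5 := mul_le_mul_of_nonneg_left (h.f_sub_le_envGap (x k ω))
      (by positivity : 0 ≤ 4 * K)
    have h6 : ‖x (k + 1) ω - x k ω‖ ≤ 2 * α k *
        (|Lφ| + ‖g k ω - gradient f (x k ω)‖ + ‖gradient f (x k ω)‖) := by
      refine h1.trans (mul_le_mul_of_nonneg_left ?_ (by linarith [h.step_pos k]))
      linarith
    have h7 := pow_le_pow_left₀ (norm_nonneg _) h6 2
    refine h7.trans ?_
    rw [mul_pow, mul_pow]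
    set a := ‖g k ω - gradient f (x k ω)‖
    set b := ‖gradient f (x k ω)‖
    -- Together with the square of 2α this produces the constant 12; 8K comes from ‖∇f‖² ≤ 4K(f -
    -- fbar) ≤ 8KV.
    have h8 : (|Lφ| + a + b) ^ 2 ≤ 3 * (|Lφ| ^ 2 + a ^ 2 + b ^ 2) := by
      nlinarith [sq_nonneg (|Lφ| - a), sq_nonneg (|Lφ| - b), sq_nonneg (a - b)]
    rw [sq_abs] at h8
    have h9 : 0 ≤ α k ^ 2 := sq_nonneg _
    calc 2 ^ 2 * α k ^ 2 * (|Lφ| + a + b) ^ 2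
        ≤ 2 ^ 2 * α k ^ 2 * (3 * (Lφ ^ 2 + a ^ 2 + b ^ 2)) := by gcongr
      _ = 12 * α k ^ 2 * (Lφ ^ 2 + b ^ 2 + a ^ 2) := by ring
      _ ≤ _ := by
        gcongr
        linarith
  have hint : Integrable (fun ω => ‖x (k + 1) ω - x k ω‖ ^ 2) ν := by
    refine hZ.mono' (hm.pow 2) ?_
    filter_upwards [hle] with ω hω
    rwa [Real.norm_of_nonneg (sq_nonneg _)]
  refine ⟨(memLp_two_iff_integrable_sq hm).2 hint, fun B hB => ?_⟩
  have h1 := integral_mono_ae hint.integrableOn hZ.integrableOn (ae_restrict_of_ae (s := B) hle)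
  refine h1.trans ?_
  rw [integral_const_mul, integral_add hY.integrableOn he.integrableOn]
  have hα2 : 0 ≤ 12 * α k ^ 2 := by positivity
  refine (mul_le_mul_of_nonneg_left (add_le_add le_rfl (heB B hB)) hα2).trans ?_
  have hW : Integrable (fun ω => 2 * C * envGap K τ f φ (fbar + φbar) (x k ω) + D) ν :=
    (hV.const_mul (2 * C)).add (integrable_const D)
  rw [← integral_add hY.integrableOn hW.integrableOn, ← integral_const_mul]
  refine integral_mono ((hY.add hW).const_mul _).integrableOn
    (((hV.add (integrable_const 1)).const_mul _).const_mul _).integrableOn fun ω => ?_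
  have hV0 := h.envGap_nonneg (x k ω)
  have : 0 ≤ 12 * α k ^ 2 * ((Lφ ^ 2 + D) * envGap K τ f φ (fbar + φbar) (x k ω)
    + (2 * C + 8 * K)) := by positivity
  dsimp only
  linarith

end IsProxSGD

/-! ### Convergence of the natural residual -/

namespace IsProxSGD

variable {E : Type*} [NormedAddCommGroup E] [InnerProductSpace ℝ E] [CompleteSpace E]
  [ProperSpace E] {Ω : Type*} {mΩ : MeasurableSpace Ω} {ν : Measure Ω} {ℱ : Filtration ℕ mΩ}
  {f : E → ℝ} {φ : E → EReal} {K τ fbar φbar : ℝ} {x g : ℕ → Ω → E} {α : ℕ → ℝ} {C D : ℝ}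

theorem integrable_sub_envProx_sq (h : IsProxSGD ν ℱ f φ K τ fbar φbar x g α C D) {k : ℕ}
    (hV : Integrable (fun ω => envGap K τ f φ (fbar + φbar) (x k ω)) ν) :
    Integrable (fun ω => ‖x k ω - envProx K τ f φ (x k ω)‖ ^ 2) ν := by
  have := (h.memLp_sub_envProx hV).integrable_norm_pow two_ne_zero
  simpa only [norm_sub_rev (envProx K τ f φ _)] using this

theorem integrable_natRes_sq (h : IsProxSGD ν ℱ f φ K τ fbar φbar x g α C D) {lam : ℝ}
    (hlam : 0 < lam) (hlt : lam * τ < 1) {k : ℕ}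
    (hV : Integrable (fun ω => envGap K τ f φ (fbar + φbar) (x k ω)) ν) :
    Integrable (fun ω => ‖natRes lam f φ (x k ω)‖ ^ 2) ν := by
  refine ((h.integrable_sub_envProx_sq hV).const_mul
    ((1 + (envRate K τ + K + lam⁻¹) / (lam⁻¹ - τ)) ^ 2)).mono'
    (((h.stronglyMeasurable_natRes hlam hlt k).mono (ℱ.le k)).aestronglyMeasurable.norm.pow 2)
    (ae_of_all _ fun ω => ?_)
  rw [Real.norm_of_nonneg (sq_nonneg _), ← mul_pow]
  exact pow_le_pow_left₀ (norm_nonneg _) (h.norm_natRes_le hlam hlt _) 2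

theorem memLp_natRes (h : IsProxSGD ν ℱ f φ K τ fbar φbar x g α C D) {lam : ℝ}
    (hlam : 0 < lam) (hlt : lam * τ < 1) {k : ℕ}
    (hV : Integrable (fun ω => envGap K τ f φ (fbar + φbar) (x k ω)) ν) :
    MemLp (fun ω => natRes lam f φ (x k ω)) 2 ν :=
  (memLp_two_iff_integrable_sq_norm ((h.stronglyMeasurable_natRes hlam hlt k).mono
    (ℱ.le k)).aestronglyMeasurable).2 (h.integrable_natRes_sq hlam hlt hV)

section FiniteMeasure

variable [IsFiniteMeasure ν]

theorem envGap_bounded (h : IsProxSGD ν ℱ f φ K τ fbar φbar x g α C D)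
    (hsmall : ∀ k, α k * (2 * K + envRate K τ) ≤ 1 / 2) (hsq : Summable fun k => α k ^ 2)
    (hV : Integrable (fun ω => envGap K τ f φ (fbar + φbar) (x 0 ω)) ν) :
    (∃ c, ∀ k, ∫ ω, envGap K τ f φ (fbar + φbar) (x k ω) ∂ν ≤ c) ∧
      (Summable fun k => ∫ ω, α k * ‖x k ω - envProx K τ f φ (x k ω)‖ ^ 2 ∂ν) ∧
      ∀ᵐ ω ∂ν, ∃ c, ∀ k, envGap K τ f φ (fbar + φbar) (x k ω) ≤ c := by
  have hr := h.envRate_pos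
  have hC := h.C_nonneg
  have hD := h.D_nonneg
  have hVk := h.integrable_envGap hV
  obtain ⟨h1, h2, h3⟩ := robbins_siegmund (ν := ν) (ℱ := ℱ)
    (V := fun k ω => envGap K τ f φ (fbar + φbar) (x k ω))
    (R := fun k ω => envRate K τ * α k * ‖x k ω - envProx K τ f φ (x k ω)‖ ^ 2)
    (b := fun k => 2 * envRate K τ * (2 * C + D) * α k ^ 2)
    (fun k => by positivity) (hsq.mul_left _) (fun k ω => h.envGap_nonneg _)
    h.stronglyMeasurable_envGap hVk
    (fun k ω => mul_nonneg (mul_nonneg hr.le (h.step_pos k).le) (sq_nonneg _))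
    (fun k => (h.integrable_sub_envProx_sq (hVk k)).const_mul _)
    (fun k B hB => h.setIntegral_envGap_succ_le (hVk k) (hsmall k) hB)
  refine ⟨h1, ?_, h3⟩
  refine (h2.mul_left (envRate K τ)⁻¹).congr fun k => ?_
  rw [← integral_const_mul]
  refine integral_congr_ae (ae_of_all _ fun ω => ?_)
  have := hr.ne'
  field_simp

theorem summable_natRes_sq (h : IsProxSGD ν ℱ f φ K τ fbar φbar x g α C D)
    (hsmall : ∀ k, α k * (2 * K + envRate K τ) ≤ 1 / 2) (hsq : Summable fun k => α k ^ 2)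
    (hV : Integrable (fun ω => envGap K τ f φ (fbar + φbar) (x 0 ω)) ν) {lam : ℝ}
    (hlam : 0 < lam) (hlt : lam * τ < 1) :
    Summable fun k => ∫ ω, α k * ‖natRes lam f φ (x k ω)‖ ^ 2 ∂ν := by
  have hVk := h.integrable_envGap hV
  refine Summable.of_nonneg_of_le (fun k => integral_nonneg fun ω =>
    mul_nonneg (h.step_pos k).le (sq_nonneg _)) (fun k => ?_)
    ((h.envGap_bounded hsmall hsq hV).2.1.mul_left
      ((1 + (envRate K τ + K + lam⁻¹) / (lam⁻¹ - τ)) ^ 2))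
  rw [← integral_const_mul]
  refine integral_mono ((h.integrable_natRes_sq hlam hlt (hVk k)).const_mul _)
    (((h.integrable_sub_envProx_sq (hVk k)).const_mul _).const_mul _) fun ω => ?_
  have := mul_le_mul_of_nonneg_left
    (pow_le_pow_left₀ (norm_nonneg _) (h.norm_natRes_le hlam hlt (x k ω)) 2) (h.step_pos k).le
  dsimp only
  rw [mul_pow] at this
  linarith

/-- From t ≤ α + t²/α the second-moment bound of order α² yields a first-moment bound of order α,
without a conditional Cauchy–Schwarz inequality. -/
theorem setIntegral_increment_le (h : IsProxSGD ν ℱ f φ K τ fbar φbar x g α C D) {Lφ : ℝ}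
    (hL : ∀ y ∈ effDom φ, ∀ z ∈ effDom φ, (φ y).toReal - (φ z).toReal ≤ Lφ * ‖y - z‖) {k : ℕ}
    (hx : ∀ᵐ ω ∂ν, x k ω ∈ effDom φ)
    (hV : Integrable (fun ω => envGap K τ f φ (fbar + φbar) (x k ω)) ν)
    {B : Set Ω} (hB : MeasurableSet[ℱ k] B) :
    ∫ ω in B, ‖x (k + 1) ω - x k ω‖ ∂ν ≤ ∫ ω in B, (α k *
        (1 + 12 * (Lφ ^ 2 + 2 * C + D + 8 * K) *
          (envGap K τ f φ (fbar + φbar) (x k ω) + 1))) ∂ν := by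
  obtain ⟨hw2, hwB⟩ := h.memLp_increment hL hx hV
  have hα := h.step_pos k
  set c := 12 * (Lφ ^ 2 + 2 * C + D + 8 * K) with hc
  have hsq := hw2.integrable_sq.const_mul (α k)⁻¹
  have h1 : ∫ ω in B, ‖x (k + 1) ω - x k ω‖ ∂ν ≤
      ∫ ω in B, (α k + (α k)⁻¹ * ‖x (k + 1) ω - x k ω‖ ^ 2) ∂ν := by
    refine integral_mono (hw2.integrable one_le_two).integrableOn
      ((integrable_const (α k)).add hsq).integrableOn fun ω => ?_
    dsimp only
    set t := ‖x (k + 1) ω - x k ω‖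
    have e1 : α k + (α k)⁻¹ * t ^ 2 - t = (α k)⁻¹ * ((α k - t / 2) ^ 2 + 3 / 4 * t ^ 2) := by
      field_simp
      ring
    have : 0 ≤ (α k)⁻¹ * ((α k - t / 2) ^ 2 + 3 / 4 * t ^ 2) := by positivity
    linarith
  refine h1.trans ?_
  have hW : Integrable (fun ω => α k * (c * (envGap K τ f φ (fbar + φbar) (x k ω) + 1))) ν :=
    ((hV.add (integrable_const 1)).const_mul c).const_mul _
  have e2 : ∀ ω, α k * (1 + c * (envGap K τ f φ (fbar + φbar) (x k ω) + 1)) =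
      α k + α k * (c * (envGap K τ f φ (fbar + φbar) (x k ω) + 1)) := fun ω => by ring
  simp_rw [e2]
  rw [integral_add (integrable_const _).integrableOn hsq.integrableOn,
    integral_add (integrable_const _).integrableOn hW.integrableOn, integral_const_mul]
  refine add_le_add le_rfl ?_
  rw [inv_mul_le_iff₀ hα, ← integral_const_mul]
  refine (hwB B hB).trans (le_of_eq (integral_congr_ae (ae_of_all _ fun ω => ?_)))
  dsimp only
  ring

theorem ae_tendsto_natRes (h : IsProxSGD ν ℱ f φ K τ fbar φbar x g α C D) {Lφ : ℝ}
    (hL : ∀ y ∈ effDom φ, ∀ z ∈ effDom φ, (φ y).toReal - (φ z).toReal ≤ Lφ * ‖y - z‖)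
    (hx : ∀ k, ∀ᵐ ω ∂ν, x k ω ∈ effDom φ)
    (hsmall : ∀ k, α k * (2 * K + envRate K τ) ≤ 1 / 2) (hsum : ¬ Summable α)
    (hsq : Summable fun k => α k ^ 2)
    (hV : Integrable (fun ω => envGap K τ f φ (fbar + φbar) (x 0 ω)) ν) {lam : ℝ}
    (hlam : 0 < lam) (hlt : lam * τ < 1) :
    ∀ᵐ ω ∂ν, Tendsto (fun k => ‖natRes lam f φ (x k ω)‖) atTop (𝓝 0) := by
  have hK := h.pos
  have hC := h.C_nonneg
  have hD := h.D_nonneg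
  have hVk := h.integrable_envGap hV
  obtain ⟨⟨c, hc⟩, -, hbdd⟩ := h.envGap_bounded hsmall hsq hV
  set c₁ := 12 * (Lφ ^ 2 + 2 * C + D + 8 * K) with hc₁
  have hc₁0 : 0 ≤ c₁ := by positivity
  have hsumm := ae_summable_of_summable_integral
    (fun k ω => mul_nonneg (h.step_pos k).le (sq_nonneg ‖natRes lam f φ (x k ω)‖))
    (fun k => (h.integrable_natRes_sq hlam hlt (hVk k)).const_mul _)
    (h.summable_natRes_sq hsmall hsq hV hlam hlt)
  -- The step lengths themselves are compensated, not the noise: they are adapted with index k + 1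
  -- even if g k is not.
  have hcomp := exists_ae_tendsto_compensated (ν := ν) (ℱ := ℱ)
    (w := fun k ω => ‖x (k + 1) ω - x k ω‖)
    (H := fun k ω => α k * (1 + c₁ * (envGap K τ f φ (fbar + φbar) (x k ω) + 1)))
    (a := fun k => α k ^ 2 * (c₁ * (c + ν.real Set.univ)))
    (fun k => ((h.adapted (k + 1)).sub ((h.adapted k).mono (ℱ.mono k.le_succ))).norm)
    (fun k => (h.memLp_increment hL (hx k) (hVk k)).1) (hsq.mul_right _)
    (fun k => by
      have h1 := (h.memLp_increment hL (hx k) (hVk k)).2 Set.univ MeasurableSet.univ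
      rw [setIntegral_univ, setIntegral_univ, integral_const_mul, integral_const_mul,
        integral_add (hVk k) (integrable_const 1), integral_const, smul_eq_mul, mul_one] at h1
      refine h1.trans (mul_le_mul_of_nonneg_left (mul_le_mul_of_nonneg_left ?_ hc₁0)
        (sq_nonneg _))
      linarith [hc k])
    (fun k => (stronglyMeasurable_const.add (((h.stronglyMeasurable_envGap k).add
      stronglyMeasurable_const).const_mul _)).const_mul _)
    (fun k => ((integrable_const 1).add (((hVk k).add (integrable_const 1)).const_mul _)).const_mul _)
    (fun k B hB => h.setIntegral_increment_le hL (hx k) (hVk k) hB)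
  filter_upwards [hsumm, hcomp, hbdd] with ω hω1 hω2 hω3
  obtain ⟨M, hM, hMw⟩ := hω2
  obtain ⟨d, hd⟩ := hω3
  have hlc : 0 < lam⁻¹ - τ := by
    rw [sub_pos, ← one_div, lt_div_iff₀ hlam]
    linarith
  refine tendsto_zero_of_summable_mul_sq (M := M) (H := 1 + c₁ * (d + 1))
    (l := 1 + (lam⁻¹ + K) / (lam⁻¹ - τ)) h.step_pos hω1 hsum (fun k => norm_nonneg _)
    (by positivity) (fun k => ?_) hM
  refine (abs_norm_sub_norm_le _ _).trans ((h.norm_natRes_sub_le hlam hlt _ _).trans ?_)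
  refine mul_le_mul_of_nonneg_left ((hMw k).trans ?_) (by positivity)
  have h1 := mul_le_mul_of_nonneg_left (hd k) hc₁0
  have h2 : α k * (1 + c₁ * (envGap K τ f φ (fbar + φbar) (x k ω) + 1)) ≤
    α k * (1 + c₁ * (d + 1)) := mul_le_mul_of_nonneg_left (by linarith) (h.step_pos k).le
  linarith

end FiniteMeasure

theorem tendsto_integral_natRes [IsProbabilityMeasure ν]
    (h : IsProxSGD ν ℱ f φ K τ fbar φbar x g α C D) {Lφ : ℝ}
    (hL : ∀ y ∈ effDom φ, ∀ z ∈ effDom φ, (φ y).toReal - (φ z).toReal ≤ Lφ * ‖y - z‖)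
    (hx : ∀ k, ∀ᵐ ω ∂ν, x k ω ∈ effDom φ)
    (hsmall : ∀ k, α k * (2 * K + envRate K τ) ≤ 1 / 2) (hsum : ¬ Summable α)
    (hsq : Summable fun k => α k ^ 2)
    (hV : Integrable (fun ω => envGap K τ f φ (fbar + φbar) (x 0 ω)) ν) {lam : ℝ}
    (hlam : 0 < lam) (hlt : lam * τ < 1) :
    Tendsto (fun k => ∫ ω, ‖natRes lam f φ (x k ω)‖ ∂ν) atTop (𝓝 0) := by
  have hK := h.pos
  have hC := h.C_nonneg
  have hD := h.D_nonneg
  have hVk := h.integrable_envGap hV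
  obtain ⟨⟨c, hc⟩, -, -⟩ := h.envGap_bounded hsmall hsq hV
  set c₁ := 12 * (Lφ ^ 2 + 2 * C + D + 8 * K) with hc₁
  have hc₁0 : 0 ≤ c₁ := by positivity
  have hlc : 0 < lam⁻¹ - τ := by
    rw [sub_pos, ← one_div, lt_div_iff₀ hlam]
    linarith
  have hF2 := fun k => h.memLp_natRes hlam hlt (hVk k)
  have hF1 := fun k => ((hF2 k).integrable one_le_two).norm
  refine tendsto_zero_of_summable_mul_sq (M := fun _ => 0) (H := 1 + c₁ * (c + 1))
    (l := 1 + (lam⁻¹ + K) / (lam⁻¹ - τ)) h.step_pos ?_ hsum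
    (fun k => integral_nonneg fun ω => norm_nonneg _) (by positivity) (fun k => ?_)
    ⟨0, tendsto_const_nhds⟩
  · refine Summable.of_nonneg_of_le (fun k => mul_nonneg (h.step_pos k).le (sq_nonneg _))
      (fun k => ?_) (h.summable_natRes_sq hsmall hsq hV hlam hlt)
    rw [integral_const_mul]
    refine mul_le_mul_of_nonneg_left ?_ (h.step_pos k).le
    -- Jensen's inequality (E‖F‖)² ≤ E‖F‖², in the form of a nonnegative variance.
    have h1 := variance_nonneg (fun ω => ‖natRes lam f φ (x k ω)‖) ν
    rw [variance_eq_sub (hF2 k).norm] at h1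
    simpa using h1
  · rw [← integral_sub (hF1 (k + 1)) (hF1 k)]
    refine abs_integral_le_integral_abs.trans ?_
    have hw := ((h.memLp_increment hL (hx k) (hVk k)).1.integrable one_le_two)
    have h1 : ∫ ω, |‖natRes lam f φ (x (k + 1) ω)‖ - ‖natRes lam f φ (x k ω)‖| ∂ν ≤
        ∫ ω, (1 + (lam⁻¹ + K) / (lam⁻¹ - τ)) * ‖x (k + 1) ω - x k ω‖ ∂ν :=
      integral_mono ((hF1 (k + 1)).sub (hF1 k)).abs (hw.const_mul _) fun ω =>
        (abs_norm_sub_norm_le _ _).trans (h.norm_natRes_sub_le hlam hlt _ _)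
    refine h1.trans ?_
    rw [integral_const_mul]
    refine mul_le_mul_of_nonneg_left ?_ (by positivity)
    have h2 := h.setIntegral_increment_le hL (hx k) (hVk k) MeasurableSet.univ
    have i1 : Integrable (fun ω => envGap K τ f φ (fbar + φbar) (x k ω) + 1) ν :=
      (hVk k).add (integrable_const 1)
    rw [setIntegral_univ, setIntegral_univ, integral_const_mul,
      integral_add (integrable_const 1) (i1.const_mul _), integral_const_mul,
      integral_add (hVk k) (integrable_const 1)] at h2
    simp only [integral_const, probReal_univ, smul_eq_mul, mul_one] at h2
    have h3 := mul_le_mul_of_nonneg_left (hc k) hc₁0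
    have h4 : α k * (1 + c₁ * (∫ ω, envGap K τ f φ (fbar + φbar) (x k ω) ∂ν + 1)) ≤
      α k * (1 + c₁ * (c + 1)) := mul_le_mul_of_nonneg_left (by linarith) (h.step_pos k).le
    linarith

end IsProxSGD

/-! ### Both claims, from the tail of the iteration -/

theorem corollary3p6 (n : ℕ)
    {Ω : Type*} [mΩ : MeasurableSpace Ω] (μ : Measure Ω) [IsProbabilityMeasure μ]
    (ℱ : Filtration ℕ mΩ)
    (f : EuclideanSpace ℝ (Fin n) → ℝ) (φ : EuclideanSpace ℝ (Fin n) → EReal)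
    (x g : ℕ → Ω → EuclideanSpace ℝ (Fin n)) (α : ℕ → ℝ)
    (L : NNReal) (fbar φbar τ Lφ C D : ℝ)
    -- the smooth part: bounded below, with Lipschitz continuous gradient
    (hf_diff : Differentiable ℝ f)
    (hf_lip : LipschitzWith L (gradient f))
    (hf_bdd : ∀ y, fbar ≤ f y)
    -- the nonsmooth part: weakly convex, proper, lower semicontinuous, bounded below
    (hτ : 0 ≤ τ)
    (hφ_wcvx : WeaklyConvex τ φ)
    (hφ_proper : (effDom φ).Nonempty)
    (hφ_lsc : LowerSemicontinuous φ)
    (hφ_bdd : ∀ y, (φbar : EReal) ≤ φ y)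
    -- Lipschitz continuity on the effective domain
    (hφ_lip : ∀ y ∈ effDom φ, ∀ z ∈ effDom φ, (φ y).toReal - (φ z).toReal ≤ Lφ * ‖y - z‖)
    -- step sizes
    (hα_pos : ∀ k, 0 < α k)
    (hα_sum : ¬ Summable α)
    (hα_sq : Summable (fun k => α k ^ 2))
    -- the iterates of prox-SGD, adapted to the filtration
    (hx_adapted : StronglyAdapted ℱ x)
    (hx_step : ∀ k, ∀ᵐ ω ∂μ, x (k + 1) ω ∈ proxSet (α k) φ (x k ω - α k • g k ω))
    -- unbiased oracles with the ABC-type conditional variance bound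
    (hg_int : ∀ k, Integrable (g k) μ)
    (hg_unbiased : ∀ k, μ[g k | ℱ k] =ᵐ[μ] fun ω => gradient f (x k ω))
    (hC : 0 ≤ C) (hD : 0 ≤ D)
    (hg_var : ∀ k, ∀ᵐ ω ∂μ,
      condLExp (ℱ k) μ (fun ω' => ‖g k ω' - gradient f (x k ω')‖ₑ ^ 2) ω
        ≤ ENNReal.ofReal (C * (f (x k ω) - fbar) + D))
    -- the parameter of the natural residual
    (lam : ℝ) (hlam_pos : 0 < lam) (hlam : lam * τ < 1) :
    ((∃ θ : ℝ, 0 < θ ∧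
        ∫⁻ ω, (moreauEnv θ (fun y => (f y : EReal) + φ y) (x 0 ω)).toENNReal ∂μ < ⊤) →
      (∀ k, Integrable (fun ω => natRes lam f φ (x k ω)) μ) ∧
      Tendsto (fun k => ∫ ω, ‖natRes lam f φ (x k ω)‖ ∂μ) atTop (𝓝 0)) ∧
    (∀ᵐ ω ∂μ, Tendsto (fun k => ‖natRes lam f φ (x k ω)‖) atTop (𝓝 0)) := by
  -- L may be zero, whereas the estimates divide by the Lipschitz modulus; L + 1 is a positive
  -- modulus.
  have h : IsProxSGD μ ℱ f φ ((L : ℝ) + 1) τ fbar φbar x g α C D :=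
    { differentiable := hf_diff
      pos := by positivity
      lipschitz := fun y z => by
        have := hf_lip.dist_le_mul y z
        rw [dist_eq_norm, dist_eq_norm] at this
        linarith [norm_nonneg (y - z)]
      le_f := hf_bdd
      nonneg := hτ
      weaklyConvex := hφ_wcvx
      proper := hφ_proper
      lsc := hφ_lsc
      le_φ := hφ_bdd
      step_pos := hα_pos
      adapted := hx_adapted
      mem_proxSet := hx_step
      integrable := hg_int
      unbiased := hg_unbiased
      C_nonneg := hC
      D_nonneg := hD
      variance_le := fun k B hB => by
        rw [← setLIntegral_condLExp (ℱ.le k) μ _ hB]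
        exact lintegral_mono_ae (ae_restrict_of_ae (hg_var k)) }
  -- The shift is by N + 1, not N, so that the shifted sequence starts after at least one proximal
  -- step and hence almost surely in dom φ.
  obtain ⟨N, hN⟩ := h.exists_small_step hα_sq
  have hsum' : ¬ Summable fun k => α (k + (N + 1)) := fun hs =>
    hα_sum ((summable_nat_add_iff (N + 1)).1 hs)
  have hsq' : Summable fun k => α (k + (N + 1)) ^ 2 :=
    (summable_nat_add_iff (f := fun k => α k ^ 2) (N + 1)).2 hα_sq
  constructor
  · rintro ⟨θ, hθ, hint⟩
    have hc : 0 < 1 + envRate ((L : ℝ) + 1) τ * θ := by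
      have := h.envRate_pos
      positivity
    set c := 1 + envRate ((L : ℝ) + 1) τ * θ with hcdef
    have hV : Integrable (fun ω => envGap ((L : ℝ) + 1) τ f φ (fbar + φbar) (x 0 ω)) μ := by
      refine ⟨((h.stronglyMeasurable_envGap 0).mono (ℱ.le 0)).aestronglyMeasurable, ?_⟩
      -- `toENNReal` truncates negative values of the envelope at zero; the constant term
      -- compensates for a negative lower bound.
      have hle : ∀ ω, ‖envGap ((L : ℝ) + 1) τ f φ (fbar + φbar) (x 0 ω)‖ₑ ≤
          ENNReal.ofReal c * ((moreauEnv θ (fun y => (f y : EReal) + φ y) (x 0 ω)).toENNReal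
            + ENNReal.ofReal (-(fbar + φbar))) := by
        intro ω
        have h1 := EReal.toENNReal_le_toENNReal (h.envGap_le_moreauEnv hθ (x 0 ω))
        rw [EReal.toENNReal_of_ne_top (EReal.coe_ne_top _), EReal.toReal_coe] at h1
        have h2 : envGap ((L : ℝ) + 1) τ f φ (fbar + φbar) (x 0 ω) =
            c * ((envGap ((L : ℝ) + 1) τ f φ (fbar + φbar) (x 0 ω) / c + (fbar + φbar))
              + -(fbar + φbar)) := by
          field_simp
          ring
        rw [Real.enorm_of_nonneg (h.envGap_nonneg _), h2, ENNReal.ofReal_mul hc.le]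
        gcongr
        exact ENNReal.ofReal_add_le.trans (add_le_add h1 le_rfl)
      refine (lintegral_mono hle).trans_lt ?_
      rw [lintegral_const_mul' _ _ ENNReal.ofReal_ne_top, lintegral_add_right _ measurable_const,
        lintegral_const]
      exact ENNReal.mul_lt_top ENNReal.ofReal_lt_top (ENNReal.add_lt_top.2 ⟨hint,
        ENNReal.mul_lt_top ENNReal.ofReal_lt_top (measure_lt_top _ _)⟩)
    have hVk := h.integrable_envGap hV
    refine ⟨fun k => (h.memLp_natRes hlam_pos hlam (hVk k)).integrable one_le_two, ?_⟩
    rw [← tendsto_add_atTop_iff_nat (N + 1)]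
    exact (h.shift (N + 1)).tendsto_integral_natRes hφ_lip
      (fun k => by simpa only [add_assoc] using h.ae_mem_effDom (k + N)) hN hsum' hsq'
      (by simpa using hVk (N + 1)) hlam_pos hlam
  -- On each sublevel event of V(x^0) the restricted, merely finite measure makes V(x^0) bounded,
  -- hence integrable; countably many m cover Ω.
  · have key : ∀ m : ℕ, ∀ᵐ ω ∂μ, envGap ((L : ℝ) + 1) τ f φ (fbar + φbar) (x 0 ω) ≤ m →
        Tendsto (fun k => ‖natRes lam f φ (x k ω)‖) atTop (𝓝 0) := by
      intro m
      have hA : MeasurableSet[ℱ 0]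
          {ω | envGap ((L : ℝ) + 1) τ f φ (fbar + φbar) (x 0 ω) ≤ m} :=
        (h.stronglyMeasurable_envGap 0).measurable measurableSet_Iic
      have h' := h.restrict hA
      have hA' := ℱ.le 0 _ hA
      have hV : Integrable (fun ω => envGap ((L : ℝ) + 1) τ f φ (fbar + φbar) (x 0 ω))
          (μ.restrict {ω | envGap ((L : ℝ) + 1) τ f φ (fbar + φbar) (x 0 ω) ≤ m}) := by
        refine (integrable_const (m : ℝ)).mono'
          ((h.stronglyMeasurable_envGap 0).mono (ℱ.le 0)).aestronglyMeasurable ?_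
        filter_upwards [ae_restrict_mem hA'] with ω hω
        rw [Real.norm_of_nonneg (h.envGap_nonneg _)]
        exact hω
      have h1 := (h'.shift (N + 1)).ae_tendsto_natRes hφ_lip
        (fun k => by simpa only [add_assoc] using h'.ae_mem_effDom (k + N)) hN hsum' hsq'
        (by simpa using h'.integrable_envGap hV (N + 1)) hlam_pos hlam
      have h2 := (ae_restrict_iff' hA').1 h1
      filter_upwards [h2] with ω hω hω'
      exact (tendsto_add_atTop_iff_nat (f := fun k => ‖natRes lam f φ (x k ω)‖) (N + 1)).1
        (hω hω')
    filter_upwards [ae_all_iff.2 key] with ω hω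
    obtain ⟨m, hm⟩ := exists_nat_ge (envGap ((L : ℝ) + 1) τ f φ (fbar + φbar) (x 0 ω))
    exact hω m hm
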